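/- **Setting.** A disk in the Riemann sphere $\mathbb C\cup\{\infty\}$ is a closed round disk of signed curvature $\kappa$: of radius $1/\kappa$ if $\kappa>0$, a half-plane (with $\infty$) if $\kappa=0$, the outside of a circle of radius $1/|\kappa|$ if $\kappa<0$. Two disks are tangent if their interiors are disjoint and they meet in exactly one point. A *spin network* is a graph drawn on the sphere, all of whose vertices are three-valent (closed edges without vertices are allowed), with a natural number on each edge, such that at every vertex the sum of the three labels is even and none of them exceeds the sum of the other two. Its *chromatic evaluation* $\langle G\rangle$ is defined as follows. Replace every edge with label $n$ by $n$ parallel strands, and join the strands at each vertex without crossings. A state is a choice of a permutation of the strands on each edge, drawn so that two strands cross once if they are inverted and do not cross otherwise. A state consists of closed loops and has the value $(-1)^{e}2^{l}$, where $l$ is the number of its loops and $e$ the number of those loops that cross themselves an even number of times. Then $\langle G\rangle$ is the average of the values of all states. The network of $n\in\{2,3,4\}$ mutually tangent disks $D_1,\dots,D_n$ carrying integers $x_1,\dots,x_n$ has a vertex for each ideal triangle (region between the disks) and an edge for each point of tangency, which joins the two regions that meet there; the edge at the tangency of $D_i$ and $D_j$ has the label $x_i+x_j$. (For $n=3$ the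 two vertices are the inner and the outer ideal triangle; for $n=2$ there is no vertex, and the network is one closed edge.) **Proposition.** Let the numbers carried by the disks be their curvatures. A. If two tangent disks have integer curvatures $a,b$, then their network is a spin network, with $$\langle a,b\rangle^{o}=(-1)^{a+b}(a+b+1).$$ B. If three mutually tangent disks have non-negative integer curvatures $a,b,c$, then their network is a spin network, with $$\langle a,b,c\rangle^{o}=(-1)^{a+b+c}\,\frac{a!\,b!\,c!\,(a+b+c+1)!}{(a+b)!\,(b+c)!\,(c+a)!}.$$ C. If four mutually tangent disks have non-negative integer curvatures $a,b,c,d$, then their network is a spin network, and with $S=a+b+c+d$ and $m=\min\{a,b,c,d\}$ $$\langle a,b,c,d\rangle^{o}=\sum_{k=0}^{m}(-1)^{S+k}\,\frac{\binom ak\binom bk\binom ck\binom dk\binom{S+1}{a,b,c,d,1}}{\binom{a+b}{a}\binom{a+c}{a}\binom{a+d}{a}\binom{b+c}{b}\binom{b+d}{b}\binom{c+d}{c}\binom{S+1}{k}},$$ where $\binom{S+1}{a,b,c,d,1}=\frac{(S+1)!}{a!\,b!\,c!\,d!\,1!}$. More generally, for every four mutually tangent disks, C holds for the network obtained when the disks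 carry arbitrary non-negative integers $a,b,c,d$ in place of their curvatures. -/

import Mathlib

/-! ### Spin networks and their chromatic evaluation -/

/-- A graph drawn on the oriented sphere, with natural numbers on its edges.  Each edge `e` has the
two half-edges `(e, false)` and `(e, true)`, and `next h` is the half-edge that follows `h`
clockwise around the vertex of `h`; so the vertices are the orbits of `next`.  A closed edge
without vertices is encoded by a base point on it: its two half-edges are exchanged by `next`. -/
structure LabelledMap where
  Edge : Type
  [fintypeEdge : Fintype Edge]
  [decEqEdge : DecidableEq Edge]
  label : Edge → ℕ
  next : Edge × Bool → Edge × Bool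

namespace LabelledMap

attribute [instance] LabelledMap.fintypeEdge LabelledMap.decEqEdge

variable (N : LabelledMap)

/-- The other half of the same edge. -/
def opp (h : N.Edge × Bool) : N.Edge × Bool := (h.1, !h.2)

/-- `h` is half of a closed edge without vertices. -/
def OnCircle (h : N.Edge × Bool) : Prop := N.next h = N.opp h ∧ N.next (N.next h) = h

/-- `h` starts at a three-valent vertex whose labels satisfy the parity condition and the triangle
inequalities (the latter for all three edges, when required of all three half-edges). -/
def AtAdmissibleVertex (h : N.Edge × Bool) : Prop :=
  N.next h ≠ h ∧ N.next (N.next (N.next h)) = h ∧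
    Even (N.label h.1 + N.label (N.next h).1 + N.label (N.next (N.next h)).1) ∧
    N.label h.1 ≤ N.label (N.next h).1 + N.label (N.next (N.next h)).1

/-- Euler's relation `V + F = E + 2 C`: the surface carrying the map is a union of spheres, one for
each connected component.  (`Quot` identifies along the equivalence relation generated.) -/
def IsPlanar : Prop :=
  Nat.card (Quot fun h h' : N.Edge × Bool => N.next h = h') +
      Nat.card (Quot fun h h' : N.Edge × Bool => N.next (N.opp h) = h') =
    Fintype.card N.Edge +
      2 * Nat.card (Quot fun h h' : N.Edge × Bool => N.next h = h' ∨ N.opp h = h')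

/-- A spin network: a planar graph, all of whose vertices are three-valent and admissible
(vertex-free closed edges are allowed). -/
def IsSpinNetwork : Prop :=
  (∀ h, N.OnCircle h ∨ N.AtAdmissibleVertex h) ∧ N.IsPlanar

/-- Each edge `e` is replaced by `N.label e` parallel strands.  `⟨e, b, s⟩` is the end of a strand
at the half-edge `(e, b)`; the ends at a half-edge are numbered clockwise around the vertex. -/
abbrev StrandEnd : Type := Σ e : N.Edge, Bool × Fin (N.label e)

/-- A state: one term of the symmetrizer (a permutation of the strands) on every edge. -/
abbrev State : Type := ∀ e : N.Edge, Equiv.Perm (Fin (N.label e))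

open Classical in
/-- The number of strands that turn from `h` to `next h` at the vertex of `h`: half of
`label h + label (next h) -` the label of the third edge, and all strands on a closed edge. -/
noncomputable def turning (h : N.Edge × Bool) : ℕ :=
  if N.OnCircle h then N.label h.1
  else (N.label h.1 + N.label (N.next h).1 - N.label (N.next (N.next h)).1) / 2

/-- The planar connection of the strands at the vertices: the last strands of `h` are joined to the
first ones of `next h`, without crossings. -/
def VertexJoin (x y : N.StrandEnd) : Prop :=
  N.next (x.1, x.2.1) = (y.1, y.2.1) ∧ (y.2.2 : ℕ) < N.turning (x.1, x.2.1) ∧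
    (x.2.2 : ℕ) + y.2.2 + 1 = N.label x.1

/-- The connection along the edges in the state `σ`.  The numbering is clockwise at both ends of
an edge, so that the trivial permutation joins `s` to `Fin.rev s`. -/
def EdgeJoin (σ : N.State) (x y : N.StrandEnd) : Prop :=
  ∃ (e : N.Edge) (s : Fin (N.label e)), x = ⟨e, false, s⟩ ∧ y = ⟨e, true, Fin.rev (σ e s)⟩

/-- The closed loops of the state `σ`. -/
def Loop (σ : N.State) : Type := Quot fun x y => N.VertexJoin x y ∨ N.EdgeJoin σ x y

/-- The loop through the strand that starts at position `s` of the half-edge `(e, false)`. -/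
def loopOf (σ : N.State) (e : N.Edge) (s : Fin (N.label e)) : N.Loop σ :=
  Quot.mk _ ⟨e, false, s⟩

/-- The number of self-crossings of a loop.  Crossings occur only inside the edges, where two
strands cross (once) if the permutation on the edge inverts them. -/
noncomputable def selfCrossings (σ : N.State) (ℓ : N.Loop σ) : ℕ :=
  Nat.card {c : Σ e : N.Edge, Fin (N.label e) × Fin (N.label e) //
    c.2.1 < c.2.2 ∧ σ c.1 c.2.2 < σ c.1 c.2.1 ∧
      N.loopOf σ c.1 c.2.1 = ℓ ∧ N.loopOf σ c.1 c.2.2 = ℓ}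

/-- The value `(-1) ^ (number of even loops) * 2 ^ (number of loops)` of a state; a loop is even if
it crosses itself an even number of times (a circle has value `-2`, a figure eight `2`). -/
noncomputable def stateValue (σ : N.State) : ℚ :=
  (-1) ^ Nat.card {ℓ : N.Loop σ // Even (N.selfCrossings σ ℓ)} * 2 ^ Nat.card (N.Loop σ)

/-- The chromatic evaluation: the average of the values of all states. -/
noncomputable def evaluation : ℚ :=
  (∑ σ : N.State, N.stateValue σ) / Fintype.card N.State

end LabelledMap

/-! ### Arrangements of mutually tangent disks -/

/-- A closed disk of signed curvature `curv` in the Riemann sphere, namely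
`{z | curv * |z|² - 2 Re (conj w * z) + cocurv ≤ 0}`.  For `curv ≠ 0` its boundary is the circle of
radius `1 / |curv|` around `w / curv`, and the disk is the inside if `curv > 0`, the outside with
`∞` if `curv < 0`.  For `curv = 0` it is a half-plane (with `∞`) with inward unit normal `w`. -/
structure Disk where
  curv : ℝ
  cocurv : ℝ
  w : ℂ
  normalized : Complex.normSq w - curv * cocurv = 1

namespace Disk

/-- The defining function of a disk; at `∞` it has the sign of its leading coefficient. -/
def form (D : Disk) (p : OnePoint ℂ) : ℝ :=
  p.elim D.curv fun z =>
    D.curv * Complex.normSq z - 2 * ((starRingEnd ℂ) D.w * z).re + D.cocurv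

/-- The points of the closed disk. -/
def carrier (D : Disk) : Set (OnePoint ℂ) := {p | D.form p ≤ 0}

/-- The points of the open disk. -/
def inner (D : Disk) : Set (OnePoint ℂ) := {p | D.form p < 0}

/-- Two disks are tangent: they do not overlap, and they meet in exactly one point (which is `∞`
for two half-planes). -/
def Tangent (D E : Disk) : Prop :=
  Disjoint D.inner E.inner ∧ ∃ p, D.carrier ∩ E.carrier = {p}

/-- The light-cone lift of a point of the Riemann sphere. -/
def lift (p : OnePoint ℂ) : Fin 4 → ℝ :=
  p.elim ![0, 1, 0, 0] fun z => ![1, Complex.normSq z, z.re, z.im]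

/-- Three points `p, q, r` of the boundary circle of `D` follow each other in this order when one
goes around `D` with `D` on the left.  (For the unit disk, whose first row is `![1, -1, 0, 0]`, the
determinant is four times the signed area of the triangle `p q r`; for the upper half-plane it is
`(q - p) * (r - p) * (r - q)`; and its sign is invariant under Möbius transformations.) -/
def PositivelyOrdered (D : Disk) (p q r : OnePoint ℂ) : Prop :=
  0 < (Matrix.of ![![D.curv, D.cocurv, D.w.re, D.w.im], lift p, lift q, lift r]).det

end Disk

/-- Any two of the disks are tangent. -/
def MutuallyTangent {n : ℕ} (D : Fin n → Disk) : Prop :=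
  ∀ i j, i ≠ j → (D i).Tangent (D j)

/-- Going around `D j` with `D j` on the left, the first point of tangency after the one with `D i`
is the one with `D k`. -/
def Follows {n : ℕ} (D : Fin n → Disk) (j i k : Fin n) : Prop :=
  k ≠ j ∧ k ≠ i ∧ ∀ l, l ≠ j → l ≠ i → l ≠ k →
    ∀ p ∈ (D j).carrier ∩ (D i).carrier, ∀ q ∈ (D j).carrier ∩ (D k).carrier,
      ∀ r ∈ (D j).carrier ∩ (D l).carrier, (D j).PositivelyOrdered p q r

open Classical in
/-- The disk that touches `D j` next after `D i`, going around `D j` with `D j` on the left.  It is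
`D i` again if there is no other disk. -/
noncomputable def successor {n : ℕ} (D : Fin n → Disk) (j i : Fin n) (h : i ≠ j) :
    {k : Fin n // k ≠ j} :=
  if hk : ∃ k, Follows D j i k then ⟨hk.choose, hk.choose_spec.1⟩ else ⟨i, h⟩

/-- The tangencies of `n` mutually tangent disks. -/
abbrev Tangency (n : ℕ) : Type := {e : Fin n × Fin n // e.1 < e.2}

/-- The half-edge `i → j` at the tangency of the disks `i` and `j`: the half that lies on the right
when one looks from the disk `i` towards the disk `j`. -/
def halfEdge {n : ℕ} (i j : Fin n) (h : i ≠ j) : Tangency n × Bool :=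
  if hij : i < j then (⟨(i, j), hij⟩, false)
  else (⟨(j, i), lt_of_le_of_ne (not_lt.mp hij) h.symm⟩, true)

/-- The network of an arrangement of mutually tangent disks that carry the numbers `x i`.

Its edges are the tangencies, labelled by the sum of the numbers of the two disks, and its vertices
are the regions between the disks: the region on the right of the tangency of `i` and `j` has in its
boundary the arc of the circle of `j` from there to the next tangency, with `k` say; hence the
clockwise successor of the half-edge `i → j` around this region is `j → k`.  (Two disks alone have
no ideal triangle around them, and their tangency is a closed edge.) -/
noncomputable def diskNetwork {n : ℕ} (D : Fin n → Disk) (x : Fin n → ℤ) : LabelledMap where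
  Edge := Tangency n
  label e := (x e.1.1 + x e.1.2).toNat
  next
    | (e, false) =>
      halfEdge e.1.2 (successor D e.1.2 e.1.1 e.2.ne).1 (successor D e.1.2 e.1.1 e.2.ne).2.symm
    | (e, true) =>
      halfEdge e.1.1 (successor D e.1.1 e.1.2 e.2.ne').1 (successor D e.1.1 e.1.2 e.2.ne').2.symm

/-- The closed formula for four circles. -/
def fourCircleSum (a b c d : ℕ) : ℚ :=
  ∑ k ∈ Finset.range (min (min a b) (min c d) + 1), (-1) ^ (a + b + c + d + k) *
    ((a.choose k * b.choose k * c.choose k * d.choose k *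
      Nat.multinomial Finset.univ ![a, b, c, d, 1] : ℕ) : ℚ) /
    (((a + b).choose a * (a + c).choose a * (a + d).choose a * (b + c).choose b *
      (b + d).choose b * (c + d).choose c * (a + b + c + d + 1).choose k : ℕ) : ℚ)

/-! The chromatic evaluation is the value at -2 of a polynomial that counts colourings (Penrose). In
a planar network two different loops cross an even number of times, so the product of the signs of
the permutations of a state is -1 to the number of its loops with odd self-crossing number. Hence
the value of a state is its sign times (-2) to the number of loops (`Corners.stateValue_eq`).

Replace -2 by a natural number n. Then n to the number of loops counts the colourings of the loops
with n colours, and the sum over states and colourings can be exchanged. If a colouring of the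
strand ends repeats a colour on an edge, exchanging two strands of that colour cancels its states in
pairs; otherwise at most one state is compatible with it, and no two strands of one colour cross, so
the sign is 1. The signed sum therefore counts the colourings without repetition on any edge
(`Corners.sum_stateSign_mul_pow`).

In such a colouring each colour occupies a set of corners that forms disjoint cycles of the network.
In the networks at hand a nonempty set of this kind is one of a short list of cycles, so that a
colouring amounts to a family of disjoint sets of colours, one for each cycle, and orderings at the
corners. Families of m colours in total are counted by falling factorials of n, and the falling
factorial of length m takes the value (-1)^m (m+1)! at -2. This gives
`Corners.evaluation_eq_sum_cycles`.

For three disks the cycles go around the disks, and the disk carrying x has x strands at each of its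
corners; one term results. For four disks the network is a tetrahedron with four triangles and three
quadrilaterals; the corner sizes force the same number k of colours on each quadrilateral and x - k
on the triangle around the disk that carries x, whence the sum over k.

The Jordan curve argument is replaced by the parity condition `Corners.Balanced`, which is checked
for each network. Geometry enters through the cyclic order of the tangencies around the disks. In
the Lorentzian model of circles, tangent disks are unit vectors with product -1 whose sum is a
positive multiple of the null vector of the point of tangency. For four disks, one determinant
decides between two mirror-image systems of cyclic orders (`exists_cyclicOrder`). -/

open Finset

/-! ### Weighted numbers of ordered pairs -/

/-- The sum of `u p * w q` over all pairs of positions `p < q < L`. -/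
def ordSum (L : ℕ) (u w : ℕ → ℤ) : ℤ :=
  ∑ p ∈ range L, ∑ q ∈ range L, if p < q then u p * w q else 0

theorem ordSum_congr {L : ℕ} {u u' w w' : ℕ → ℤ} (hu : ∀ p < L, u p = u' p)
    (hw : ∀ p < L, w p = w' p) : ordSum L u w = ordSum L u' w' := by
  refine sum_congr rfl fun p hp => sum_congr rfl fun q hq => ?_
  rw [hu p (mem_range.1 hp), hw q (mem_range.1 hq)]

theorem ordSum_swap {L : ℕ} {u w : ℕ → ℤ} (h : ∀ p < L, u p * w p = 0) :
    ordSum L u w + ordSum L w u = (∑ p ∈ range L, u p) * ∑ p ∈ range L, w p := by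
  unfold ordSum
  rw [sum_comm (f := fun p q => if p < q then w p * u q else 0), ← sum_add_distrib, sum_mul_sum]
  refine sum_congr rfl fun p hp => ?_
  rw [← sum_add_distrib]
  refine sum_congr rfl fun q hq => ?_
  rcases lt_trichotomy p q with hpq | rfl | hpq
  · simp [hpq, hpq.not_gt]
  · simp [h p (mem_range.1 hp)]
  · simp [hpq, hpq.not_gt, mul_comm]

theorem ordSum_add (m k : ℕ) (u w : ℕ → ℤ) :
    ordSum (m + k) u w = ordSum m u w + ordSum k (fun p => u (m + p)) (fun p => w (m + p)) +
      (∑ p ∈ range m, u p) * ∑ q ∈ range k, w (m + q) := by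
  unfold ordSum
  rw [sum_range_add]
  simp only [sum_range_add _ m k, sum_add_distrib, add_lt_add_iff_left]
  have h1 : ∑ p ∈ range m, ∑ q ∈ range k, (if p < m + q then u p * w (m + q) else 0) =
      (∑ p ∈ range m, u p) * ∑ q ∈ range k, w (m + q) := by
    rw [sum_mul_sum]
    refine sum_congr rfl fun p hp => sum_congr rfl fun q _ => if_pos ?_
    have := mem_range.1 hp
    omega
  have h2 : ∑ p ∈ range k, ∑ q ∈ range m, (if m + p < q then u (m + p) * w q else 0) = 0 := by
    refine sum_eq_zero fun p _ => sum_eq_zero fun q hq => if_neg ?_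
    have := mem_range.1 hq
    omega
  rw [h1, h2]
  ring

theorem ordSum_reflect (L : ℕ) (u w : ℕ → ℤ) :
    ordSum L (fun p => u (L - 1 - p)) (fun p => w (L - 1 - p)) = ordSum L w u := by
  unfold ordSum
  rw [sum_comm (f := fun p q => if p < q then w p * u q else 0), ← sum_range_reflect]
  refine sum_congr rfl fun p hp => ?_
  rw [← sum_range_reflect]
  refine sum_congr rfl fun q hq => ?_
  have hp := mem_range.1 hp
  have hq := mem_range.1 hq
  have e1 : L - 1 - (L - 1 - p) = p := by omega
  have e2 : L - 1 - (L - 1 - q) = q := by omega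
  have e3 : L - 1 - p < L - 1 - q ↔ q < p := by omega
  simp only [e1, e2, e3, mul_comm]

/-! ### Corners, and the parity of the crossings between two loops -/

namespace LabelledMap

variable (N : LabelledMap)

/-- The strand end at position `p` of the half-edge `h`. -/
def strandEnd (h : N.Edge × Bool) (p : ℕ) (hp : p < N.label h.1) : N.StrandEnd :=
  ⟨h.1, h.2, ⟨p, hp⟩⟩

/-- A description of the vertices by their corners: `size h` strands turn from `h` to `next h`. -/
structure Corners where
  prev : N.Edge × Bool → N.Edge × Bool
  size : N.Edge × Bool → ℕ
  next_prev : ∀ h, N.next (prev h) = h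
  prev_next : ∀ h, prev (N.next h) = h
  size_add : ∀ h, size (prev h) + size h = N.label h.1
  size_le : ∀ h, size h ≤ N.turning h
  two_valent : ∀ h, size h ≠ N.turning h →
    N.next (N.next h) = h ∧ N.label (N.next h).1 = N.label h.1

namespace Corners

variable {N} (K : N.Corners)

theorem size_le_label (h : N.Edge × Bool) : K.size h ≤ N.label h.1 := by
  have := K.size_add h
  omega

theorem size_le_label_next (h : N.Edge × Bool) : K.size h ≤ N.label (N.next h).1 := by
  have := K.size_add (N.next h)
  rw [K.prev_next] at this
  omega

/-- A function on the strand ends is constant along the connections at the vertices iff it is so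
at every corner. -/
theorem forall_vertexJoin_iff {α : Type*} (f : N.StrandEnd → α) :
    (∀ x y, N.VertexJoin x y → f x = f y) ↔
      ∀ h r (_ : r < K.size h) (hl : N.label h.1 - 1 - r < N.label h.1)
        (hn : r < N.label (N.next h).1),
        f (N.strandEnd h (N.label h.1 - 1 - r) hl) = f (N.strandEnd (N.next h) r hn) := by
  constructor
  · intro H h r hr hl hn
    refine H _ _ ⟨rfl, hr.trans_le (K.size_le h), ?_⟩
    have := K.size_le_label h
    simp only [strandEnd]
    omega
  · have aux : (∀ h r (_ : r < K.size h) (hl : N.label h.1 - 1 - r < N.label h.1)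
        (hn : r < N.label (N.next h).1),
        f (N.strandEnd h (N.label h.1 - 1 - r) hl) = f (N.strandEnd (N.next h) r hn)) →
        ∀ x y : N.StrandEnd, N.next (x.1, x.2.1) = (y.1, y.2.1) →
        (y.2.2 : ℕ) < K.size (x.1, x.2.1) → (x.2.2 : ℕ) + y.2.2 + 1 = N.label x.1 →
        f x = f y := by
      rintro H ⟨e, b, s⟩ ⟨e', b', s'⟩ h1 h2 h3
      dsimp only at h1 h2 h3
      have hs' : (s' : ℕ) < N.label (N.next (e, b)).1 := by rw [h1]; exact s'.2
      have := H (e, b) s' h2 (by dsimp only; omega) hs'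
      have e1 : N.strandEnd (e, b) (N.label e - 1 - s') (by dsimp only; omega) = ⟨e, b, s⟩ := by
        simp only [strandEnd]
        congr 2
        ext
        dsimp only
        omega
      have e2 : N.strandEnd (N.next (e, b)) s' hs' = ⟨e', b', s'⟩ := by
        generalize N.next (e, b) = h at h1 hs'
        subst h1
        rfl
      rwa [e1, e2] at this
    rintro H x y ⟨h1, h2, h3⟩
    -- A join that is not counted by the corner of its first half-edge occurs only on a closed edge.
    -- There the same two ends are joined in the opposite direction too, and that join is counted by
    -- the other corner.
    by_cases hs : (y.2.2 : ℕ) < K.size (x.1, x.2.1)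
    · exact aux H x y h1 hs h3
    · obtain ⟨hn, hlab⟩ := K.two_valent (x.1, x.2.1) (by omega)
      symm
      have hprev : K.prev (x.1, x.2.1) = (y.1, y.2.1) := by
        rw [← h1]
        conv_lhs => rw [← hn]
        exact K.prev_next _
      have hsz := K.size_add (x.1, x.2.1)
      rw [h1] at hlab
      rw [hprev] at hsz
      refine aux H y x (by rw [← h1, hn]) ?_ ?_
      · dsimp only at hsz
        omega
      · dsimp only at hlab
        omega

/-- The parity condition on the numbers of strands of two families of loops at the corners which
makes any two loops cross an even number of times. -/
def Balanced : Prop :=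
  ∀ a b : N.Edge × Bool → ℤ,
    (∀ h, a h + a (K.prev h) = a (N.opp h) + a (K.prev (N.opp h))) →
    (∀ h, b h + b (K.prev h) = b (N.opp h) + b (K.prev (N.opp h))) →
    Even (∑ e, (a (e, false) + a (K.prev (e, false))) * (b (e, true) + b (K.prev (e, false))))

def prevEquiv : N.Edge × Bool ≃ N.Edge × Bool where
  toFun := K.prev
  invFun := N.next
  left_inv := K.next_prev
  right_inv := K.prev_next

end Corners

section Crossings

variable {N} {C : Type*} [DecidableEq C] (f : N.StrandEnd → C)

/-- The indicator function of the positions of colour `c` at the half-edge `h`. -/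
def indicator (c : C) (h : N.Edge × Bool) (p : ℕ) : ℤ :=
  if hp : p < N.label h.1 then (if f (N.strandEnd h p hp) = c then 1 else 0) else 0

theorem indicator_mul_indicator {c c' : C} (hc : c ≠ c') (h : N.Edge × Bool) (p : ℕ) :
    indicator f c h p * indicator f c' h p = 0 := by
  unfold indicator
  split_ifs with _ h1 h2 <;> simp
  exact hc (h1.symm.trans h2)

/-- The number of crossings of a strand of colour `c` on the left and one of colour `c'` on the
right (seen from the first half of the edge). -/
def crossings (σ : N.State) (c c' : C) : ℕ :=
  ∑ e, ∑ s, ∑ t, if s < t ∧ σ e t < σ e s ∧ f ⟨e, false, s⟩ = c ∧ f ⟨e, false, t⟩ = c' then 1 else 0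

/-- The numbering is clockwise at both ends, so left and right are exchanged between them. A pair of
strands that is not inverted is counted at both ends or at neither, which accounts for `2 * m`; an
inverted pair is counted exactly once. -/
theorem crossings_edge (e : N.Edge) (τ : Equiv.Perm (Fin (N.label e)))
    (hτ : ∀ s, f ⟨e, false, s⟩ = f ⟨e, true, Fin.rev (τ s)⟩) {c c' : C} (hc : c ≠ c') :
    ∃ m : ℤ, ordSum (N.label e) (indicator f c (e, false)) (indicator f c' (e, false)) +
        ordSum (N.label e) (indicator f c' (e, true)) (indicator f c (e, true)) =
      (∑ s, ∑ t, if s < t ∧ τ t < τ s ∧ f ⟨e, false, s⟩ = c ∧ f ⟨e, false, t⟩ = c' then 1 else 0) +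
      (∑ s, ∑ t, if s < t ∧ τ t < τ s ∧ f ⟨e, false, s⟩ = c' ∧ f ⟨e, false, t⟩ = c then 1 else 0) +
        2 * m := by
  set U : Fin (N.label e) → ℤ := fun s => if f ⟨e, false, s⟩ = c then 1 else 0 with hU
  set W : Fin (N.label e) → ℤ := fun s => if f ⟨e, false, s⟩ = c' then 1 else 0 with hW
  have h1 : ordSum (N.label e) (indicator f c (e, false)) (indicator f c' (e, false)) =
      ∑ s, ∑ t, if s < t then U s * W t else 0 := by
    unfold ordSum
    rw [sum_range]
    refine sum_congr rfl fun s _ => ?_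
    rw [sum_range]
    refine sum_congr rfl fun t _ => ?_
    simp only [indicator, Fin.is_lt, dite_true, strandEnd, Fin.eta, Fin.val_fin_lt]
    rfl
  have h2 : ordSum (N.label e) (indicator f c' (e, true)) (indicator f c (e, true)) =
      ∑ s, ∑ t, if τ s < τ t then U s * W t else 0 := by
    unfold ordSum
    rw [sum_comm, sum_range, ← (τ.trans Fin.revPerm).sum_comp]
    refine sum_congr rfl fun s _ => ?_
    rw [sum_range, ← (τ.trans Fin.revPerm).sum_comp]
    refine sum_congr rfl fun t _ => ?_
    have hs := hτ s
    have ht := hτ t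
    have e1 : indicator f c (e, true) ↑(Fin.rev (τ s)) = U s := by
      simp only [indicator, Fin.is_lt, dite_true, hU, hs, strandEnd, Fin.eta]
      rfl
    have e2 : indicator f c' (e, true) ↑(Fin.rev (τ t)) = W t := by
      simp only [indicator, Fin.is_lt, dite_true, hW, ht, strandEnd, Fin.eta]
      rfl
    simp only [Equiv.trans_apply, Fin.revPerm_apply]
    rw [e1, e2]
    simp only [Fin.val_fin_lt, Fin.rev_lt_rev, mul_comm]
  refine ⟨∑ s, ∑ t, if s < t ∧ τ s < τ t then U s * W t else 0, ?_⟩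
  rw [h1, h2, sum_comm (f := fun s t => if s < t ∧ τ t < τ s ∧ f ⟨e, false, s⟩ = c' ∧
    f ⟨e, false, t⟩ = c then (1 : ℤ) else 0), mul_sum, ← sum_add_distrib, ← sum_add_distrib,
    ← sum_add_distrib]
  refine sum_congr rfl fun s _ => ?_
  rw [mul_sum, ← sum_add_distrib, ← sum_add_distrib, ← sum_add_distrib]
  refine sum_congr rfl fun t _ => ?_
  by_cases hs : f ⟨e, false, s⟩ = c
  · by_cases ht : f ⟨e, false, t⟩ = c'
    · have hst : s ≠ t := by
        rintro rfl
        exact hc (hs.symm.trans ht)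
      have hst' : τ s ≠ τ t := fun h => hst (τ.injective h)
      rcases lt_or_gt_of_ne hst with h | h <;> rcases lt_or_gt_of_ne hst' with h' | h' <;>
        simp [hU, hW, hs, ht, h, h', h.not_gt, h'.not_gt]
    · simp [hU, hW, ht]
  · simp [hU, hW, hs]

/-- By `crossings_edge` the number of crossings is, modulo 2, a sum of order counts at the
half-edges. These are regrouped around the vertices: since the strands of a corner are joined
without crossings, only products of the numbers of strands at the corners survive, and `Balanced`
says that their sum is even. -/
theorem Corners.even_crossings (K : N.Corners) (hK : K.Balanced) (σ : N.State)
    (hv : ∀ x y, N.VertexJoin x y → f x = f y) (he : ∀ x y, N.EdgeJoin σ x y → f x = f y)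
    {c c' : C} (hc : c ≠ c') : Even (crossings f σ c c' + crossings f σ c' c) := by
  classical
  rw [K.forall_vertexJoin_iff] at hv
  set u := indicator f c with hu
  set w := indicator f c' with hw
  have huw : ∀ h p, u h p * w h p = 0 := fun h p => indicator_mul_indicator f hc h p
  have hind : ∀ c'' h r, r < K.size h → indicator f c'' h (N.label h.1 - 1 - r) =
      indicator f c'' (N.next h) r := by
    intro c'' h r hr
    have hl : N.label h.1 - 1 - r < N.label h.1 := by
      have := K.size_le_label h
      omega
    have hn := hr.trans_le (K.size_le_label_next h)
    simp only [indicator, hl, hn, dite_true, hv h r hr hl hn]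
  -- The numbers of strands of the two colours at the corner of `h`.
  let a (h : N.Edge × Bool) : ℤ := ∑ r ∈ range (K.size h), u (N.next h) r
  let b (h : N.Edge × Bool) : ℤ := ∑ r ∈ range (K.size h), w (N.next h) r
  have hsum : ∀ c'' h, ∑ p ∈ range (N.label h.1), indicator f c'' h p =
      (∑ r ∈ range (K.size h), indicator f c'' (N.next h) r) +
        ∑ r ∈ range (K.size (K.prev h)), indicator f c'' (N.next (K.prev h)) r := by
    intro c'' h
    rw [K.next_prev, ← K.size_add h, sum_range_add, add_comm]
    congr 1
    rw [← sum_range_reflect]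
    refine sum_congr rfl fun r hr => ?_
    have hr := mem_range.1 hr
    rw [← hind c'' h r hr]
    congr 1
    have := K.size_add h
    omega
  have hedge : ∀ c'' (h : N.Edge × Bool), ∑ p ∈ range (N.label h.1), indicator f c'' h p =
      ∑ p ∈ range (N.label (N.opp h).1), indicator f c'' (N.opp h) p := by
    have key : ∀ c'' (e : N.Edge), ∑ p ∈ range (N.label e), indicator f c'' (e, false) p =
        ∑ p ∈ range (N.label e), indicator f c'' (e, true) p := by
      intro c'' e
      symm
      rw [sum_range, sum_range, ← ((σ e).trans Fin.revPerm).sum_comp]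
      refine sum_congr rfl fun s _ => ?_
      have := he _ _ ⟨e, s, rfl, rfl⟩
      simp only [indicator, Fin.is_lt, dite_true, strandEnd, Fin.eta, this, Equiv.trans_apply,
        Fin.revPerm_apply]
    rintro c'' ⟨e, _ | _⟩
    · exact key c'' e
    · exact (key c'' e).symm
  have ha : ∀ h, a h + a (K.prev h) = a (N.opp h) + a (K.prev (N.opp h)) := fun h => by
    have := hedge c h
    rwa [hsum, hsum] at this
  have hb : ∀ h, b h + b (K.prev h) = b (N.opp h) + b (K.prev (N.opp h)) := fun h => by
    have := hedge c' h
    rwa [hsum, hsum] at this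
  -- The positions of `h` split into those of the corner of `prev h` and those of its own corner.
  -- The latter are joined to the first positions of `next h` in reverse, which exchanges `u` and
  -- `w`.
  have hord : ∀ h, ordSum (N.label h.1) (u h) (w h) =
      ordSum (K.size (K.prev h)) (u h) (w h) +
        ordSum (K.size h) (w (N.next h)) (u (N.next h)) + a (K.prev h) * b h := by
    intro h
    have hsz := K.size_add h
    have hr : ∀ c'', ∀ r < K.size h, indicator f c'' h (K.size (K.prev h) + r) =
        indicator f c'' (N.next h) (K.size h - 1 - r) := by
      intro c'' r hr
      rw [← hind c'' h _ (by omega)]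
      congr 1
      omega
    rw [← hsz, ordSum_add, ordSum_congr (hr c) (hr c'), ordSum_reflect,
      sum_congr rfl fun r h => hr c' r (mem_range.1 h), sum_range_reflect]
    simp only [a, b, K.next_prev]
    rfl
  -- Each corner is seen from its two half-edges in opposite orders, so by `ordSum_swap` its two
  -- contributions add up to the product `a h * b h`.
  have hvert : ∑ h, ordSum (N.label h.1) (u h) (w h) = ∑ h, (a h + a (K.prev h)) * b h := by
    simp only [hord, sum_add_distrib, add_mul]
    congr 1
    have := K.prevEquiv.sum_comp
      (fun h => ordSum (K.size h) (u (N.next h)) (w (N.next h)))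
    simp only [Corners.prevEquiv, Equiv.coe_fn_mk, K.next_prev] at this
    rw [this, ← sum_add_distrib]
    exact sum_congr rfl fun h _ => ordSum_swap fun p _ => huw _ p
  choose m hm using fun e => crossings_edge f e (σ e) (fun s => he _ _ ⟨e, s, rfl, rfl⟩) hc
  -- The edge formula has the colours exchanged at the second end, the vertex formula does not; the
  -- two counts add up to the product of the numbers of strands of both colours.
  have hswap : ∀ e, ordSum (N.label e) (w (e, true)) (u (e, true)) =
      (a (e, false) + a (K.prev (e, false))) * (b (e, false) + b (K.prev (e, false))) -
        ordSum (N.label e) (u (e, true)) (w (e, true)) := by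
    intro e
    have h1 := ordSum_swap (L := N.label e) (fun p _ => huw (e, true) p)
    have h2 := hsum c (e, true)
    have h3 := hsum c' (e, true)
    have h4 := ha (e, false)
    have h5 := hb (e, false)
    simp only [opp, Bool.not_false] at h4 h5
    rw [h4, h5]
    simp only [a, b]
    rw [← h2, ← h3]
    linarith
  rw [Fintype.sum_prod_type, Fintype.sum_prod_type] at hvert
  simp only [Fintype.sum_bool, sum_add_distrib] at hvert
  obtain ⟨k, hk⟩ := hK a b ha hb
  have htot := sum_congr (s₁ := (univ : Finset N.Edge)) rfl fun e _ => hm e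
  simp only [sum_add_distrib, ← mul_sum] at htot
  have hX : ((crossings f σ c c' + crossings f σ c' c : ℕ) : ℤ) =
      ∑ e, (∑ s, ∑ t, if s < t ∧ σ e t < σ e s ∧ f ⟨e, false, s⟩ = c ∧ f ⟨e, false, t⟩ = c'
        then 1 else 0) +
      ∑ e, ∑ s, ∑ t, if s < t ∧ σ e t < σ e s ∧ f ⟨e, false, s⟩ = c' ∧ f ⟨e, false, t⟩ = c
        then 1 else 0 := by
    simp [crossings]
  rw [← Int.even_coe_nat, hX]
  have hB : ∑ e, (a (e, true) + a (K.prev (e, true))) * b (e, true) =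
      ∑ e, (a (e, false) + a (K.prev (e, false))) * b (e, true) :=
    sum_congr rfl fun e _ => by
      have := ha (e, true)
      simp only [opp, Bool.not_true] at this
      rw [this]
  have hsw := sum_congr (s₁ := (univ : Finset N.Edge)) rfl fun e _ => hswap e
  simp only [mul_add, sum_sub_distrib, sum_add_distrib] at hsw hk
  refine ⟨k + ∑ e, (a (e, false) + a (K.prev (e, false))) * b (e, false)
    - ∑ e, m e - ∑ e, ordSum (N.label e) (u (e, true)) (w (e, true)), ?_⟩
  linarith

end Crossings

end LabelledMap

/-! ### The signed state sum as a count of colourings -/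

theorem Equiv.Perm.sign_eq_neg_one_pow_inversions {n : ℕ} (σ : Equiv.Perm (Fin n)) :
    (Equiv.Perm.sign σ : ℤ) = (-1) ^ ∑ s, ∑ t, if s < t ∧ σ t < σ s then 1 else 0 := by
  rw [σ.sign_eq_prod_prod_Ioi]
  simp only [Units.coe_prod, ← prod_pow_eq_pow_sum]
  refine prod_congr rfl fun s _ => ?_
  have : Ioi s = univ.filter fun t => s < t := by
    ext
    simp
  rw [this, prod_filter]
  refine prod_congr rfl fun t _ => ?_
  by_cases h : s < t
  · have hne : σ s ≠ σ t := fun h' => h.ne (σ.injective h')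
    rcases lt_or_gt_of_ne hne with h' | h' <;> simp [h, h', h'.not_gt]
  · simp [h]

namespace LabelledMap

variable {N : LabelledMap}

/-- The product of the signs of the permutations on the edges. -/
def stateSign (σ : N.State) : ℤ := ∏ e, (Equiv.Perm.sign (σ e) : ℤ)

/-- The sign counts all crossings modulo 2. Those between different colours cancel in the pairs `(c,
c')`, `(c', c)` by `even_crossings`. The colours may be coarser than the loops, which is used for
colourings below. -/
theorem Corners.stateSign_eq (K : N.Corners) (hK : K.Balanced) {C : Type*} [DecidableEq C]
    [Fintype C] (f : N.StrandEnd → C) (σ : N.State)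
    (hv : ∀ x y, N.VertexJoin x y → f x = f y) (he : ∀ x y, N.EdgeJoin σ x y → f x = f y) :
    stateSign σ = (-1) ^ ∑ c, crossings f σ c c := by
  have htot : ∑ e, ∑ s, ∑ t, (if s < t ∧ σ e t < σ e s then 1 else 0) =
      ∑ c : C × C, crossings f σ c.1 c.2 := by
    simp only [crossings]
    symm
    rw [sum_comm]
    refine sum_congr rfl fun e _ => ?_
    rw [sum_comm]
    refine sum_congr rfl fun s _ => ?_
    rw [sum_comm]
    refine sum_congr rfl fun t _ => ?_
    rw [sum_eq_single (f ⟨e, false, s⟩, f ⟨e, false, t⟩)]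
    · simp
    · rintro ⟨c, c'⟩ _ h
      refine if_neg ?_
      rintro ⟨-, -, rfl, rfl⟩
      exact h rfl
    · simp
  have hsplit : (∑ c : C × C, (crossings f σ c.1 c.2 : ZMod 2)) =
      ∑ c, (crossings f σ c c : ZMod 2) := by
    rw [← univ_product_univ, ← diag_union_offDiag, sum_union (disjoint_diag_offDiag _), sum_diag,
      sum_involution (s := univ.offDiag) (fun c _ => c.swap)]
    · simp
    · rintro ⟨c, c'⟩ h
      rw [mem_offDiag] at h
      have := K.even_crossings f hK σ hv he h.2.2
      have := (ZMod.natCast_eq_zero_iff_even).2 this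
      exact_mod_cast this
    · rintro ⟨c, c'⟩ h _ h'
      rw [mem_offDiag] at h
      exact h.2.2 (congrArg Prod.snd h')
    · rintro ⟨c, c'⟩ h
      rw [mem_offDiag] at h ⊢
      exact ⟨mem_univ _, mem_univ _, h.2.2.symm⟩
    · simp
  have hcong : (∑ c : C × C, crossings f σ c.1 c.2) ≡ ∑ c, crossings f σ c c [MOD 2] := by
    rw [← ZMod.natCast_eq_natCast_iff]
    exact_mod_cast hsplit
  unfold stateSign
  simp only [Equiv.Perm.sign_eq_neg_one_pow_inversions, prod_pow_eq_pow_sum]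
  rw [htot, neg_one_pow_eq_pow_mod_two, hcong, ← neg_one_pow_eq_pow_mod_two]

instance (σ : N.State) : Finite (N.Loop σ) :=
  inferInstanceAs (Finite (Quot _))

theorem selfCrossings_eq (σ : N.State) [DecidableEq (N.Loop σ)]
    (ℓ : N.Loop σ) :
    N.selfCrossings σ ℓ = crossings (C := N.Loop σ) (Quot.mk _) σ ℓ ℓ := by
  change _ = ∑ e, ∑ s, ∑ t, if s < t ∧ σ e t < σ e s ∧ N.loopOf σ e s = ℓ ∧ N.loopOf σ e t = ℓ
    then 1 else 0
  rw [selfCrossings, Nat.subtype_card (univ.filter fun c : Σ e : N.Edge,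
    Fin (N.label e) × Fin (N.label e) => c.2.1 < c.2.2 ∧ σ c.1 c.2.2 < σ c.1 c.2.1 ∧
      N.loopOf σ c.1 c.2.1 = ℓ ∧ N.loopOf σ c.1 c.2.2 = ℓ) (by intro x; simp), card_filter,
    ← univ_sigma_univ, sum_sigma]
  refine sum_congr rfl fun e _ => ?_
  rw [Fintype.sum_prod_type]

/-- With the loops themselves as colours, a loop contributes -1 to the power of its self-crossings
to the sign. Times -2 this is -2 for an even loop and 2 for an odd one, as in `stateValue`. -/
theorem Corners.stateValue_eq (K : N.Corners) (hK : K.Balanced) (σ : N.State) :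
    N.stateValue σ = stateSign σ * (-2) ^ Nat.card (N.Loop σ) := by
  classical
  have := Fintype.ofFinite (N.Loop σ)
  have h := K.stateSign_eq hK (C := N.Loop σ) (Quot.mk _) σ
    (fun x y h => Quot.sound (Or.inl h)) (fun x y h => Quot.sound (Or.inr h))
  rw [h]
  unfold stateValue
  rw [Nat.subtype_card (univ.filter fun ℓ : N.Loop σ => Even (N.selfCrossings σ ℓ))
    (by intro x; simp), Nat.card_eq_fintype_card]
  simp only [← selfCrossings_eq]
  rw [← card_univ, ← prod_const, ← prod_const, ← prod_const, prod_filter, ← prod_mul_distrib,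
    ← prod_pow_eq_pow_sum]
  push_cast
  rw [← prod_mul_distrib]
  refine prod_congr rfl fun ℓ _ => ?_
  by_cases hℓ : Even (N.selfCrossings σ ℓ)
  · simp [hℓ]
  · simp [hℓ, (Nat.not_even_iff_odd.1 hℓ).neg_one_pow]

/-- `f` is constant along the edges in some state, and no two strands of an edge have the same
value. -/
def Rainbow {C : Type*} (f : N.StrandEnd → C) : Prop :=
  ∀ e, Function.Injective (fun s => f ⟨e, false, s⟩) ∧
    Set.range (fun s => f ⟨e, false, s⟩) = Set.range (fun s => f ⟨e, true, s⟩)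

def EdgeCompatible {C : Type*} (f : N.StrandEnd → C) (σ : N.State) : Prop :=
  ∀ e s, f ⟨e, false, s⟩ = f ⟨e, true, Fin.rev (σ e s)⟩

theorem edgeCompatible_iff {C : Type*} (f : N.StrandEnd → C) (σ : N.State) :
    EdgeCompatible f σ ↔ ∀ x y, N.EdgeJoin σ x y → f x = f y := by
  constructor
  · rintro h _ _ ⟨e, s, rfl, rfl⟩
    exact h e s
  · intro h e s
    exact h _ _ ⟨e, s, rfl, rfl⟩

theorem exists_edgeCompatible_iff {C : Type*} (f : N.StrandEnd → C)
    (hf : ∀ e, Function.Injective (fun s => f ⟨e, false, s⟩)) :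
    (∃ σ, EdgeCompatible f σ) ↔ Rainbow f := by
  constructor
  · rintro ⟨σ, hσ⟩ e
    refine ⟨hf e, ?_⟩
    rw [← ((σ e).trans Fin.revPerm).surjective.range_comp fun s => f ⟨e, true, s⟩]
    congr 1
    funext s
    simpa using hσ e s
  · intro h
    have : ∀ e, ∃ τ : Equiv.Perm (Fin (N.label e)),
        ∀ s, f ⟨e, false, s⟩ = f ⟨e, true, Fin.rev (τ s)⟩ := by
      intro e
      have h1 : ∀ s, ∃ t, f ⟨e, true, t⟩ = f ⟨e, false, s⟩ := fun s => by
        have : f ⟨e, false, s⟩ ∈ Set.range (fun s => f ⟨e, true, s⟩) := (h e).2 ▸ ⟨s, rfl⟩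
        exact this
      choose t ht using h1
      have hinj : Function.Injective fun s => Fin.rev (t s) := by
        intro s s' hs
        have hs := Fin.rev_injective hs
        exact hf e (by simp only [← ht, hs])
      refine ⟨Equiv.ofBijective _ (Finite.injective_iff_bijective.1 hinj), fun s => ?_⟩
      simp [ht]
    choose τ hτ using this
    exact ⟨τ, fun e s => hτ e s⟩

theorem eq_of_edgeCompatible {C : Type*} {f : N.StrandEnd → C} (hf : Rainbow f) {σ τ : N.State}
    (hσ : EdgeCompatible f σ) (hτ : EdgeCompatible f τ) : σ = τ := by
  funext e
  ext1 s
  have hinj : Function.Injective fun s => f ⟨e, true, s⟩ := by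
    intro t t' h
    obtain ⟨s, rfl⟩ := ((σ e).trans Fin.revPerm).surjective t
    obtain ⟨s', rfl⟩ := ((σ e).trans Fin.revPerm).surjective t'
    have : s = s' := (hf e).1 ((hσ e s).trans (h.trans (hσ e s').symm))
    rw [this]
  exact Fin.rev_injective (hinj ((hσ e s).symm.trans (hτ e s)))

/-- If two strands of an edge have the same colour, composing with their transposition is a
sign-reversing involution without fixed points. If not, the colours determine the state, and its
sign is 1 by `stateSign_eq` because no two strands of one colour cross. -/
theorem Corners.sum_stateSign_compatible (K : N.Corners) (hK : K.Balanced) {C : Type*}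
    [DecidableEq C] [Fintype C] (f : N.StrandEnd → C) (hv : ∀ x y, N.VertexJoin x y → f x = f y)
    [DecidablePred (EdgeCompatible f)] [Decidable (Rainbow f)] :
    ∑ σ with EdgeCompatible f σ, stateSign σ = if Rainbow f then 1 else 0 := by
  by_cases hf : ∀ e, Function.Injective (fun s => f ⟨e, false, s⟩)
  · split_ifs with hR
    · obtain ⟨σ, hσ⟩ := (exists_edgeCompatible_iff f hf).2 hR
      have : (univ.filter fun σ => EdgeCompatible f σ) = {σ} := by
        ext τ
        simp only [mem_filter, mem_univ, true_and, mem_singleton]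
        exact ⟨fun h => eq_of_edgeCompatible hR h hσ, fun h => h ▸ hσ⟩
      rw [this, sum_singleton, K.stateSign_eq hK f σ hv ((edgeCompatible_iff f σ).1 hσ)]
      have : ∀ c, crossings f σ c c = 0 := by
        intro c
        refine sum_eq_zero fun e _ => sum_eq_zero fun s _ => sum_eq_zero fun t _ => if_neg ?_
        rintro ⟨h1, -, h2, h3⟩
        exact h1.ne (hf e (h2.trans h3.symm))
      simp [this]
    · refine sum_eq_zero fun σ hσ => ?_
      exact (hR ((exists_edgeCompatible_iff f hf).1 ⟨σ, (mem_filter.1 hσ).2⟩)).elim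
  · rw [if_neg fun h => hf fun e => (h e).1]
    simp only [not_forall, Function.Injective] at hf
    obtain ⟨e, s, t, hst, hne⟩ := hf
    have hswap : ∀ x, f ⟨e, false, Equiv.swap s t x⟩ = f ⟨e, false, x⟩ := by
      intro x
      rcases eq_or_ne x s with rfl | hs
      · rw [Equiv.swap_apply_left, hst]
      · rcases eq_or_ne x t with rfl | ht
        · rw [Equiv.swap_apply_right, hst]
        · rw [Equiv.swap_apply_of_ne_of_ne hs ht]
    refine sum_involution (fun σ _ => Function.update σ e (σ e * Equiv.swap s t)) ?_ ?_ ?_ ?_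
    · intro σ _
      have h1 := prod_update_of_mem (mem_univ e) (fun e => (Equiv.Perm.sign (σ e) : ℤ))
        (Equiv.Perm.sign (σ e * Equiv.swap s t) : ℤ)
      have h2 : ∀ e', (Equiv.Perm.sign (Function.update σ e (σ e * Equiv.swap s t) e') : ℤ) =
          Function.update (fun e => (Equiv.Perm.sign (σ e) : ℤ)) e
            (Equiv.Perm.sign (σ e * Equiv.swap s t) : ℤ) e' := by
        intro e'
        rcases eq_or_ne e' e with rfl | h
        · simp
        · simp [h]
      unfold stateSign
      simp only [h2]
      rw [h1, ← mul_prod_erase univ _ (mem_univ e), Equiv.Perm.sign_mul, Equiv.Perm.sign_swap hne,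
        sdiff_singleton_eq_erase]
      simp
    · intro σ _ _ h
      have := congrFun h e
      rw [Function.update_self, mul_eq_left, Equiv.swap_eq_one_iff] at this
      exact hne this
    · intro σ hσ
      simp only [mem_filter, mem_univ, true_and] at hσ ⊢
      intro e' x
      rcases eq_or_ne e' e with rfl | h
      · rw [Function.update_self, Equiv.Perm.mul_apply, ← hσ, hswap]
      · rw [Function.update_of_ne h]
        exact hσ e' x
    · intro σ _
      simp [mul_assoc]

/-- The colourings of the strands that are counted by the state sum. -/
def goodColourings (N : LabelledMap) (C : Type*) : Set (N.StrandEnd → C) :=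
  {f | (∀ x y, N.VertexJoin x y → f x = f y) ∧ Rainbow f}

/-- The power of `n` counts the colourings of the loops, that is, the colourings of the strand ends
compatible with the vertices and with the state; then the order of summation is exchanged. -/
theorem Corners.sum_stateSign_mul_pow (K : N.Corners) (hK : K.Balanced) (n : ℕ) :
    ∑ σ : N.State, stateSign σ * (n : ℤ) ^ Nat.card (N.Loop σ) =
      Nat.card (N.goodColourings (Fin n)) := by
  classical
  have hloop : ∀ σ : N.State, (n : ℤ) ^ Nat.card (N.Loop σ) =
      ∑ f : N.StrandEnd → Fin n with (∀ x y, N.VertexJoin x y → f x = f y),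
        if EdgeCompatible f σ then 1 else 0 := by
    intro σ
    have e : (N.Loop σ → Fin n) ≃ {f : N.StrandEnd → Fin n //
        (∀ x y, N.VertexJoin x y → f x = f y) ∧ EdgeCompatible f σ} :=
      { toFun := fun g => ⟨fun x => g (Quot.mk _ x),
          fun x y h => congrArg g (Quot.sound (Or.inl h)),
          (edgeCompatible_iff _ _).2 fun x y h => congrArg g (Quot.sound (Or.inr h))⟩
        invFun := fun f => Quot.lift f.1 fun x y h =>
          h.elim (f.2.1 x y) ((edgeCompatible_iff _ _).1 f.2.2 x y)
        left_inv := fun g => by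
          funext ℓ
          induction ℓ using Quot.ind
          rfl
        right_inv := fun f => rfl }
    have := Nat.card_congr e
    rw [Nat.card_fun, Nat.card_eq_fintype_card (α := Fin n), Fintype.card_fin] at this
    rw [← sum_filter, filter_filter, sum_const, nsmul_one]
    rw [Nat.subtype_card (univ.filter fun f : N.StrandEnd → Fin n =>
      (∀ x y, N.VertexJoin x y → f x = f y) ∧ EdgeCompatible f σ) (by intro x; simp)] at this
    exact_mod_cast this
  simp only [hloop, mul_sum]
  rw [sum_comm]
  have : ∀ f ∈ univ.filter (fun f : N.StrandEnd → Fin n =>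
      ∀ x y, N.VertexJoin x y → f x = f y),
      ∑ σ, stateSign σ * (if EdgeCompatible f σ then 1 else 0) = if Rainbow f then 1 else 0 := by
    intro f hf
    simp only [mul_ite, mul_one, mul_zero]
    rw [← sum_filter, K.sum_stateSign_compatible hK f (mem_filter.1 hf).2]
  rw [sum_congr rfl this, ← sum_filter, filter_filter, sum_const, nsmul_one]
  rw [goodColourings, ← Nat.subtype_card (p := fun f : N.StrandEnd → Fin n =>
    (∀ x y, N.VertexJoin x y → f x = f y) ∧ Rainbow f) _ (by intro x; simp)]
  rfl

/-- The product is (-2)(-3)⋯(-m-1). -/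
theorem descPochhammer_eval_neg_two (m : ℕ) :
    (descPochhammer ℚ m).eval (-2) = (-1) ^ m * ((m + 1).factorial : ℚ) := by
  induction m with
  | zero => simp
  | succ m ih =>
    rw [descPochhammer_succ_eval, ih, Nat.factorial_succ (m + 1), pow_succ]
    push_cast
    ring

/-- Both sides of `hc` are polynomials in `n`. Agreeing at all natural numbers they coincide, so
they may be evaluated at -2. -/
theorem Corners.evaluation_eq (K : N.Corners) (hK : K.Balanced) (ι : Finset ℕ) (m : ℕ → ℕ)
    (c : ℕ → ℚ) (hc : ∀ n : ℕ, (Nat.card (N.goodColourings (Fin n)) : ℚ) =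
      ∑ k ∈ ι, c k * (n.descFactorial (m k) : ℚ)) :
    N.evaluation = (∑ k ∈ ι, c k * ((-1) ^ m k * ((m k + 1).factorial : ℚ))) /
      ∏ e, ((N.label e).factorial : ℚ) := by
  let P : Polynomial ℚ := ∑ σ : N.State,
    Polynomial.C (stateSign σ : ℚ) * Polynomial.X ^ Nat.card (N.Loop σ)
  let Q : Polynomial ℚ := ∑ k ∈ ι, Polynomial.C (c k) * descPochhammer ℚ (m k)
  have hPQ : P = Q := by
    refine Polynomial.eq_of_infinite_eval_eq _ _
      ((Set.infinite_range_of_injective (Nat.cast_injective (R := ℚ))).mono ?_)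
    rintro _ ⟨n, rfl⟩
    have h1 := K.sum_stateSign_mul_pow hK n
    have h2 := congrArg (Int.cast : ℤ → ℚ) h1
    push_cast at h2
    rw [hc n] at h2
    simp only [Set.mem_ofPred_eq, P, Q, Polynomial.eval_finsetSum, Polynomial.eval_mul,
      Polynomial.eval_C, Polynomial.eval_pow, Polynomial.eval_X,
      descPochhammer_eval_eq_descFactorial]
    exact h2
  have hval : ∑ σ : N.State, N.stateValue σ = P.eval (-2) := by
    simp only [K.stateValue_eq hK, P, Polynomial.eval_finsetSum, Polynomial.eval_mul,
      Polynomial.eval_C, Polynomial.eval_pow, Polynomial.eval_X]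
  rw [evaluation, hval, hPQ]
  simp only [Q, Polynomial.eval_finsetSum, Polynomial.eval_mul, Polynomial.eval_C,
    descPochhammer_eval_neg_two]
  congr 1
  rw [Fintype.card_pi]
  simp [Fintype.card_perm]

end LabelledMap

/-! ### Counting families of sets by injections -/

section Counting

variable {ι X : Type*} [Fintype ι] [DecidableEq ι] [Fintype X] [DecidableEq X]

/-- Families of injections with images of a given kind are counted by the families of images. -/
theorem card_injections (m : ι → ℕ) (P : (ι → Finset X) → Prop) :
    Nat.card {g : ∀ i, Fin (m i) → X //
        (∀ i, Function.Injective (g i)) ∧ P fun i => univ.image (g i)} =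
      (∏ i, (m i).factorial) * Nat.card {A : ι → Finset X // (∀ i, #(A i) = m i) ∧ P A} := by
  classical
  -- An injection amounts to its image together with a bijection onto the image.
  let Φ : (Σ A : {A : ι → Finset X // (∀ i, #(A i) = m i) ∧ P A}, ∀ i, Fin (m i) ≃ A.1 i) →
      {g : ∀ i, Fin (m i) → X // (∀ i, Function.Injective (g i)) ∧ P fun i => univ.image (g i)} :=
    fun p => ⟨fun i r => (p.2 i r).1, fun i => Subtype.val_injective.comp (p.2 i).injective, by
      have : (fun i => univ.image fun r => (p.2 i r).1) = p.1.1 := by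
        funext i
        ext x
        simp only [mem_image, mem_univ, true_and]
        constructor
        · rintro ⟨r, rfl⟩
          exact (p.2 i r).2
        · intro hx
          exact ⟨(p.2 i).symm ⟨x, hx⟩, by simp⟩
      rw [this]
      exact p.1.2.2⟩
  have himage : ∀ p i, univ.image ((Φ p).1 i) = p.1.1 i := by
    intro p i
    ext x
    simp only [mem_image, mem_univ, true_and, Φ]
    constructor
    · rintro ⟨r, rfl⟩
      exact (p.2 i r).2
    · intro hx
      exact ⟨(p.2 i).symm ⟨x, hx⟩, by simp⟩
  have hΦ : Function.Bijective Φ := by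
    constructor
    · rintro p q h
      have hA : p.1 = q.1 := by
        ext1
        funext i
        rw [← himage, ← himage, h]
      obtain ⟨A, e⟩ := p
      obtain ⟨A', e'⟩ := q
      obtain rfl : A = A' := hA
      congr
      funext i
      ext r
      have := congrFun (congrFun (congrArg Subtype.val h) i) r
      exact this
    · rintro ⟨g, hg, hP⟩
      refine ⟨⟨⟨fun i => univ.image (g i), fun i => ?_, hP⟩, fun i =>
        Equiv.ofBijective (fun r => ⟨g i r, mem_image_of_mem _ (mem_univ r)⟩) ⟨?_, ?_⟩⟩, rfl⟩
      · rw [card_image_of_injective _ (hg i), card_univ, Fintype.card_fin]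
      · intro r r' h
        exact hg i (congrArg Subtype.val h)
      · rintro ⟨x, hx⟩
        obtain ⟨r, -, rfl⟩ := mem_image.1 hx
        exact ⟨r, rfl⟩
  rw [← Nat.card_congr (Equiv.ofBijective Φ hΦ), Nat.card_eq_fintype_card, Fintype.card_sigma,
    Nat.card_eq_fintype_card, sum_congr rfl (g := fun _ => ∏ i, (m i).factorial), sum_const,
    smul_eq_mul, mul_comm, card_univ]
  rintro ⟨A, hA, -⟩ -
  rw [Fintype.card_pi]
  refine prod_congr rfl fun i _ => ?_
  have : Fintype.card (A i) = m i := by rw [Fintype.card_coe, hA]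
  rw [Fintype.card_equiv (Fintype.equivOfCardEq (by rw [this, Fintype.card_fin])),
    Fintype.card_fin]

/-- The number of families of disjoint sets of given sizes. -/
theorem card_disjoint_families (m : ι → ℕ) :
    (∏ i, (m i).factorial) *
        Nat.card {B : ι → Finset X // (∀ i, #(B i) = m i) ∧
          ∀ i j, i ≠ j → Disjoint (B i) (B j)} =
      (Fintype.card X).descFactorial (∑ i, m i) := by
  classical
  rw [← card_injections]
  -- Injections with pairwise disjoint images are a single embedding of the disjoint union of their
  -- domains.
  have e : {g : ∀ i, Fin (m i) → X // (∀ i, Function.Injective (g i)) ∧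
      ∀ i j, i ≠ j → Disjoint (univ.image (g i)) (univ.image (g j))} ≃
      ((Σ i, Fin (m i)) ↪ X) :=
    { toFun := fun g => ⟨fun p => g.1 p.1 p.2, by
        rintro ⟨i, r⟩ ⟨j, s⟩ h
        by_cases hij : i = j
        · subst hij
          exact congrArg _ (g.2.1 i h)
        · refine (disjoint_left.1 (g.2.2 i j hij) (mem_image_of_mem _ (mem_univ r)) ?_).elim
          exact mem_image.2 ⟨s, mem_univ _, h.symm⟩⟩
      invFun := fun φ => ⟨fun i r => φ ⟨i, r⟩, fun i r s h => by simpa using φ.injective h, by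
        intro i j hij
        rw [disjoint_left]
        intro x hx hx'
        obtain ⟨r, -, rfl⟩ := mem_image.1 hx
        obtain ⟨s, -, hs⟩ := mem_image.1 hx'
        exact hij (congrArg Sigma.fst (φ.injective hs)).symm⟩
      left_inv := fun g => rfl
      right_inv := fun φ => rfl }
  rw [Nat.card_congr e, Nat.card_eq_fintype_card, Fintype.card_embedding_eq, Fintype.card_sigma]
  simp

end Counting

/-! ### Colourings as families of disjoint sets on cycles -/

namespace LabelledMap.Corners

variable {N : LabelledMap} (K : N.Corners)

section Families

variable {X : Type*}

/-- The colouring of the strand ends by colours that are given at the corners. -/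
def colour (g : ∀ h, Fin (K.size h) → X) (h : N.Edge × Bool) (p : Fin (N.label h.1)) : X :=
  if hp : (p : ℕ) < K.size (K.prev h) then g (K.prev h) ⟨p, hp⟩
  else g h ⟨N.label h.1 - 1 - p, by have := K.size_add h; omega⟩

theorem colour_first (g : ∀ h, Fin (K.size h) → X) (h : N.Edge × Bool)
    (r : Fin (K.size (K.prev h))) (hr : (r : ℕ) < N.label h.1) :
    K.colour g h ⟨r, hr⟩ = g (K.prev h) r := by
  simp [colour]

theorem colour_next (g : ∀ h, Fin (K.size h) → X) (h : N.Edge × Bool)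
    (r : Fin (K.size h)) (hr : (r : ℕ) < N.label (N.next h).1) :
    K.colour g (N.next h) ⟨r, hr⟩ = g h r := by
  have aux : ∀ h' (hh : h' = h) (hr' : (r : ℕ) < K.size h'), g h' ⟨r, hr'⟩ = g h r := by
    rintro _ rfl _
    rfl
  have hlt : (r : ℕ) < K.size (K.prev (N.next h)) := by
    rw [K.prev_next]
    exact r.2
  simp only [colour, hlt, dite_true]
  exact aux _ (K.prev_next h) _

theorem colour_last (g : ∀ h, Fin (K.size h) → X) (h : N.Edge × Bool)
    (r : Fin (K.size h)) (hr : N.label h.1 - 1 - r < N.label h.1) :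
    K.colour g h ⟨N.label h.1 - 1 - r, hr⟩ = g h r := by
  have := K.size_add h
  have hlt : ¬ N.label h.1 - 1 - r < K.size (K.prev h) := by omega
  simp only [colour, hlt, dite_false]
  congr 1
  ext
  simp only
  omega

theorem range_colour (g : ∀ h, Fin (K.size h) → X) (h : N.Edge × Bool) :
    Set.range (K.colour g h) = Set.range (g h) ∪ Set.range (g (K.prev h)) := by
  have hsz := K.size_add h
  ext x
  constructor
  · rintro ⟨p, rfl⟩
    unfold colour
    split_ifs with hp
    · exact Or.inr ⟨_, rfl⟩
    · exact Or.inl ⟨_, rfl⟩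
  · rintro (⟨r, rfl⟩ | ⟨r, rfl⟩)
    · exact ⟨_, K.colour_last g h r (by omega)⟩
    · exact ⟨_, K.colour_first g h r (by omega)⟩

theorem injective_colour_iff (g : ∀ h, Fin (K.size h) → X) (h : N.Edge × Bool) :
    Function.Injective (K.colour g h) ↔ Function.Injective (g h) ∧
      Function.Injective (g (K.prev h)) ∧ Disjoint (Set.range (g h)) (Set.range (g (K.prev h))) := by
  have hsz := K.size_add h
  constructor
  · intro hinj
    refine ⟨fun r s hrs => ?_, fun r s hrs => ?_, ?_⟩
    · rw [← K.colour_last g h r (by omega), ← K.colour_last g h s (by omega)] at hrs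
      have := congrArg Fin.val (hinj hrs)
      ext
      simp only at this
      omega
    · rw [← K.colour_first g h r (by omega), ← K.colour_first g h s (by omega)] at hrs
      have := congrArg Fin.val (hinj hrs)
      exact Fin.ext this
    · rw [Set.disjoint_left]
      rintro _ ⟨r, rfl⟩ ⟨s, hs⟩
      rw [← K.colour_last g h r (by omega), ← K.colour_first g h s (by omega)] at hs
      have := congrArg Fin.val (hinj hs)
      simp only at this
      omega
  · rintro ⟨h1, h2, h3⟩ p q hpq
    unfold colour at hpq
    split_ifs at hpq with hp hq hq
    · have := congrArg Fin.val (h2 hpq)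
      exact Fin.ext this
    · exact (Set.disjoint_left.1 h3 ⟨_, rfl⟩ ⟨_, hpq⟩).elim
    · exact (Set.disjoint_left.1 h3 ⟨_, rfl⟩ ⟨_, hpq.symm⟩).elim
    · have := congrArg Fin.val (h1 hpq)
      ext
      simp only at this
      omega

theorem rainbow_injective {f : N.StrandEnd → X} (hf : Rainbow f) (h : N.Edge × Bool) :
    Function.Injective fun s => f ⟨h.1, h.2, s⟩ := by
  obtain ⟨e, _ | _⟩ := h
  · exact (hf e).1
  · obtain ⟨σ, hσ⟩ := (exists_edgeCompatible_iff f fun e => (hf e).1).2 hf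
    intro t t' h
    obtain ⟨s, rfl⟩ := ((σ e).trans Fin.revPerm).surjective t
    obtain ⟨s', rfl⟩ := ((σ e).trans Fin.revPerm).surjective t'
    have : s = s' := (hf e).1 ((hσ e s).trans (h.trans (hσ e s').symm))
    rw [this]

/-- The conditions on the sets of colours at the corners of a colouring that counts. -/
def GoodFamily [DecidableEq X] (A : N.Edge × Bool → Finset X) : Prop :=
  (∀ h, Disjoint (A h) (A (K.prev h))) ∧
    ∀ h, A h ∪ A (K.prev h) = A (N.opp h) ∪ A (K.prev (N.opp h))

/-- The colours of a corner are read off at the first positions of the next half-edge; the joins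
then determine the last positions of the half-edge before. Having no repetition on an edge means
that adjacent corners have disjoint colour sets, and agreement of the two ends of an edge means
equality of the unions. -/
def goodColouringsEquiv [DecidableEq X] : N.goodColourings X ≃
    {g : ∀ h, Fin (K.size h) → X //
      (∀ h, Function.Injective (g h)) ∧ K.GoodFamily fun h => univ.image (g h)} where
  toFun f := ⟨fun h r => f.1 (N.strandEnd (N.next h) r (r.2.trans_le (K.size_le_label_next h))), by
    obtain ⟨f, hv, hR⟩ := f
    set g : ∀ h, Fin (K.size h) → X := fun h r =>
      f (N.strandEnd (N.next h) r (r.2.trans_le (K.size_le_label_next h))) with hg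
    rw [K.forall_vertexJoin_iff] at hv
    have hfg : ∀ h, K.colour g h = fun s => f ⟨h.1, h.2, s⟩ := by
      intro h
      funext p
      have := K.size_add h
      unfold colour
      split_ifs with hp
      · have aux : ∀ h' (hh : h' = h) (hp : (p : ℕ) < N.label h'.1),
          f (N.strandEnd h' p hp) = f ⟨h.1, h.2, p⟩ := by
          rintro _ rfl _
          rfl
        exact aux _ (K.next_prev h) _
      · simp only [hg]
        rw [← hv h _ (by omega) (by omega)]
        unfold strandEnd
        congr 3
        ext
        simp only
        omega
    have hinj : ∀ h, Function.Injective (K.colour g h) := fun h => by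
      rw [hfg]
      exact rainbow_injective hR h
    simp only [injective_colour_iff] at hinj
    refine ⟨fun h => (hinj h).1, fun h => ?_, fun h => ?_⟩
    · rw [← disjoint_coe]
      simpa using (hinj h).2.2
    · rw [← coe_inj]
      push_cast
      simp only [Set.image_univ, ← range_colour, hfg]
      obtain ⟨e, _ | _⟩ := h
      · exact (hR e).2
      · exact (hR e).2.symm⟩
  invFun g := ⟨fun x => K.colour g.1 (x.1, x.2.1) x.2.2, by
    obtain ⟨g, hinj, hdisj, hunion⟩ := g
    have hset : ∀ h, Set.range (g h) = (univ.image (g h) : Finset X) := by simp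
    have hc : ∀ h, Function.Injective (K.colour g h) := by
      intro h
      rw [injective_colour_iff, hset, hset, disjoint_coe]
      exact ⟨hinj _, hinj _, hdisj h⟩
    have hr : ∀ h, Set.range (K.colour g h) = Set.range (K.colour g (N.opp h)) := by
      intro h
      simp only [range_colour, hset, ← coe_union]
      rw [hunion h]
    refine ⟨?_, fun e => ⟨hc (e, false), hr (e, false)⟩⟩
    rw [K.forall_vertexJoin_iff]
    intro h r hr hl hn
    exact (K.colour_last g h ⟨r, hr⟩ hl).trans (K.colour_next g h ⟨r, hr⟩ hn).symm⟩
  left_inv f := by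
    obtain ⟨f, hv, hR⟩ := f
    rw [K.forall_vertexJoin_iff] at hv
    ext1
    funext ⟨e, b, p⟩
    have := K.size_add (e, b)
    dsimp only [colour]
    split_ifs with hp
    · have aux : ∀ h' (hh : h' = (e, b)) (hp : (p : ℕ) < N.label h'.1),
        f (N.strandEnd h' p hp) = f ⟨e, b, p⟩ := by
        rintro _ rfl _
        rfl
      exact aux _ (K.next_prev _) _
    · rw [← hv (e, b) _ (by dsimp only at this ⊢; omega) (by dsimp only; omega)]
      unfold strandEnd
      congr 3
      ext
      simp only
      omega
  right_inv g := by
    ext1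
    funext h r
    exact K.colour_next g.1 h r _

theorem card_goodColourings [DecidableEq X] [Fintype X] :
    Nat.card (N.goodColourings X) = (∏ h, (K.size h).factorial) *
      Nat.card {A : N.Edge × Bool → Finset X // (∀ h, #(A h) = K.size h) ∧ K.GoodFamily A} := by
  rw [Nat.card_congr K.goodColouringsEquiv, card_injections]

/-- `v` is the set of corners of a family of disjoint cycles. -/
def IsCycleSet (v : N.Edge × Bool → Bool) : Prop :=
  (∀ h, ¬ (v h ∧ v (K.prev h))) ∧
    ∀ h, (v h || v (K.prev h)) = (v (N.opp h) || v (K.prev (N.opp h)))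

theorem goodFamily_iff [DecidableEq X] (A : N.Edge × Bool → Finset X) :
    K.GoodFamily A ↔ ∀ x, K.IsCycleSet fun h => decide (x ∈ A h) := by
  constructor
  · rintro ⟨h1, h2⟩ x
    refine ⟨fun h => ?_, fun h => ?_⟩
    · simpa using fun h' => disjoint_left.1 (h1 h) h'
    · have := congrArg (x ∈ ·) (h2 h)
      simp only [mem_union, eq_iff_iff] at this
      simp only [← Bool.decide_or, this]
  · intro H
    refine ⟨fun h => disjoint_left.2 fun x hx hx' => ?_, fun h => ?_⟩
    · exact (H x).1 h (by simp [hx, hx'])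
    · ext x
      have := (H x).2 h
      simpa only [← Bool.decide_or, decide_eq_decide, mem_union] using this

/-- The sets of colours at the corners are described by the sets of colours on the cycles. -/
theorem card_goodFamilies [DecidableEq X] [Fintype X] {T : Type*} [Fintype T] [DecidableEq T]
    (inc : T → N.Edge × Bool → Bool) (hinc : Function.Injective inc)
    (hne : ∀ τ, inc τ ≠ fun _ => false)
    (hcyc : ∀ v, K.IsCycleSet v ↔ v = (fun _ => false) ∨ ∃ τ, v = inc τ) :
    Nat.card {A : N.Edge × Bool → Finset X // (∀ h, #(A h) = K.size h) ∧ K.GoodFamily A} =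
      Nat.card {B : T → Finset X // (∀ h, ∑ τ with inc τ h, #(B τ) = K.size h) ∧
        ∀ τ τ', τ ≠ τ' → Disjoint (B τ) (B τ')} := by
  symm
  -- By disjointness a colour belongs to at most one `B τ`, so the corners where it occurs are
  -- exactly those of `τ`.
  have hmem : ∀ (B : T → Finset X), (∀ τ τ', τ ≠ τ' → Disjoint (B τ) (B τ')) →
      ∀ x τ, x ∈ B τ → (fun h => decide (x ∈ univ.biUnion fun τ => if inc τ h then B τ else ∅)) =
        inc τ := by
    intro B hB x τ hx
    funext h
    cases hi : inc τ h
    · simp only [decide_eq_false_iff_not, mem_biUnion, mem_univ, true_and, not_exists]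
      intro τ' hτ'
      split_ifs at hτ' with h'
      · have : τ = τ' := by
          by_contra hne
          exact disjoint_left.1 (hB τ τ' hne) hx hτ'
        rw [this, h'] at hi
        cases hi
      · simp at hτ'
    · simp only [decide_eq_true_eq, mem_biUnion, mem_univ, true_and]
      exact ⟨τ, by simpa [hi] using hx⟩
  have hcard : ∀ (B : T → Finset X), (∀ τ τ', τ ≠ τ' → Disjoint (B τ) (B τ')) →
      ∀ h, #(univ.biUnion fun τ => if inc τ h then B τ else ∅) = ∑ τ with inc τ h, #(B τ) := by
    intro B hB h
    rw [card_biUnion, sum_filter]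
    · refine sum_congr rfl fun τ _ => ?_
      split_ifs <;> simp
    · intro τ _ τ' _ hne
      dsimp only [Function.onFun]
      split_ifs <;> simp [hB τ τ' hne]
  refine Nat.card_congr (Equiv.ofBijective (fun B => ⟨fun h =>
    univ.biUnion fun τ => if inc τ h then B.1 τ else ∅, fun h => ?_, ?_⟩) ⟨?_, ?_⟩)
  · rw [hcard _ B.2.2, B.2.1 h]
  · rw [goodFamily_iff]
    intro x
    rw [hcyc]
    by_cases hx : ∃ τ, x ∈ B.1 τ
    · obtain ⟨τ, hτ⟩ := hx
      exact Or.inr ⟨τ, hmem _ B.2.2 x τ hτ⟩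
    · left
      funext h
      simp only [decide_eq_false_iff_not, mem_biUnion, mem_univ, true_and, not_exists]
      intro τ hτ
      split_ifs at hτ
      · exact hx ⟨τ, hτ⟩
      · simp at hτ
  · rintro ⟨B, hB1, hB2⟩ ⟨B', hB1', hB2'⟩ heq
    have heq := congrArg Subtype.val heq
    dsimp only at heq
    have key : ∀ B B' : T → Finset X, (∀ τ τ', τ ≠ τ' → Disjoint (B τ) (B τ')) →
        (∀ τ τ', τ ≠ τ' → Disjoint (B' τ) (B' τ')) →
        ((fun h => univ.biUnion fun τ => if inc τ h then B τ else ∅) =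
          fun h => univ.biUnion fun τ => if inc τ h then B' τ else ∅) → ∀ τ, B τ ⊆ B' τ := by
      intro B B' hB hB' heq τ x hx
      have h1 := hmem B hB x τ hx
      by_cases hx' : ∃ τ', x ∈ B' τ'
      · obtain ⟨τ', hx'⟩ := hx'
        have h2 := hmem B' hB' x τ' hx'
        have : inc τ = inc τ' := by
          rw [← h1, ← h2]
          funext h
          have := congrFun heq h
          rw [this]
        rwa [hinc this]
      · refine (hne τ ?_).elim
        rw [← h1]
        funext h
        have := congrFun heq h
        rw [this]
        simp only [decide_eq_false_iff_not, mem_biUnion, mem_univ, true_and, not_exists]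
        intro τ hτ
        split_ifs at hτ
        · exact hx' ⟨τ, hτ⟩
        · simp at hτ
    ext1
    funext τ
    exact (key B B' hB2 hB2' heq τ).antisymm (key B' B hB2' hB2 heq.symm τ)
  · rintro ⟨A, hA1, hA2⟩
    rw [goodFamily_iff] at hA2
    simp only [hcyc] at hA2
    -- The colours are sorted by the cycle formed by the corners where they occur.
    let B : T → Finset X := fun τ => univ.filter fun x => (fun h => decide (x ∈ A h)) = inc τ
    have hB : ∀ τ τ', τ ≠ τ' → Disjoint (B τ) (B τ') := by
      intro τ τ' hne
      rw [disjoint_left]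
      intro x hx hx'
      exact hne (hinc ((mem_filter.1 hx).2.symm.trans (mem_filter.1 hx').2))
    have hAB : (fun h => univ.biUnion fun τ => if inc τ h then B τ else ∅) = A := by
      funext h
      ext x
      simp only [mem_biUnion, mem_univ, true_and]
      constructor
      · rintro ⟨τ, hτ⟩
        split_ifs at hτ with hi
        · have := congrFun (mem_filter.1 hτ).2 h
          rw [hi] at this
          simpa using this
        · simp at hτ
      · intro hx
        rcases hA2 x with h0 | ⟨τ, hτ⟩
        · have := congrFun h0 h
          simp [hx] at this
        · refine ⟨τ, ?_⟩
          have := congrFun hτ h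
          simp only [hx, decide_true] at this
          rw [← this, if_pos rfl]
          exact mem_filter.2 ⟨mem_univ _, hτ⟩
    refine ⟨⟨B, fun h => ?_, hB⟩, ?_⟩
    · rw [← hcard B hB h, ← hA1 h, ← hAB]
    · ext1
      exact hAB

end Families

/-- The evaluation as a sum over the families of cycles with the given numbers of strands. -/
theorem evaluation_eq_sum_cycles (hK : K.Balanced) {T : Type*} [Fintype T] [DecidableEq T]
    (inc : T → N.Edge × Bool → Bool) (hinc : Function.Injective inc)
    (hne : ∀ τ, inc τ ≠ fun _ => false)
    (hcyc : ∀ v, K.IsCycleSet v ↔ v = (fun _ => false) ∨ ∃ τ, v = inc τ)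
    (ι : Finset ℕ) (m : ℕ → T → ℕ) (hm : Set.InjOn m ι)
    (hsize : ∀ M : T → ℕ, (∀ h, ∑ τ with inc τ h, M τ = K.size h) ↔ ∃ k ∈ ι, m k = M) :
    N.evaluation = (∑ k ∈ ι, ((∏ h, ((K.size h).factorial : ℚ)) / ∏ τ, ((m k τ).factorial : ℚ)) *
        ((-1) ^ (∑ τ, m k τ) * ((∑ τ, m k τ + 1).factorial : ℚ))) /
      ∏ e, ((N.label e).factorial : ℚ) := by
  classical
  refine K.evaluation_eq hK ι (fun k => ∑ τ, m k τ)
    (fun k => (∏ h, ((K.size h).factorial : ℚ)) / ∏ τ, ((m k τ).factorial : ℚ)) fun n => ?_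
  rw [K.card_goodColourings, K.card_goodFamilies inc hinc hne hcyc]
  -- The families are sorted by the sizes of their members; `hsize` lists the possible size vectors,
  -- and `hm` makes the classes disjoint.
  have hsum : Nat.card {B : T → Finset (Fin n) // (∀ h, ∑ τ with inc τ h, #(B τ) = K.size h) ∧
        ∀ τ τ', τ ≠ τ' → Disjoint (B τ) (B τ')} =
      ∑ k ∈ ι, Nat.card {B : T → Finset (Fin n) // (∀ τ, #(B τ) = m k τ) ∧
        ∀ τ τ', τ ≠ τ' → Disjoint (B τ) (B τ')} := by
    have h1 : ∀ P : (T → Finset (Fin n)) → Prop, Nat.card {B // P B} = #(univ.filter P) :=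
      fun P => Nat.subtype_card _ (by intro x; simp)
    simp only [h1]
    rw [← card_biUnion]
    · congr 1
      ext B
      simp only [mem_filter, mem_univ, true_and, mem_biUnion]
      rw [hsize fun τ => #(B τ)]
      constructor
      · rintro ⟨⟨k, hk, h⟩, hB⟩
        exact ⟨k, hk, fun τ => (congrFun h τ).symm, hB⟩
      · rintro ⟨k, hk, h, hB⟩
        exact ⟨⟨k, hk, funext fun τ => (h τ).symm⟩, hB⟩
    · intro k hk k' hk' hne
      rw [Function.onFun, disjoint_left]
      intro B hB hB'
      simp only [mem_filter, mem_univ, true_and] at hB hB'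
      exact hne (hm hk hk' (funext fun τ => (hB.1 τ).symm.trans (hB'.1 τ)))
  rw [hsum]
  push_cast
  rw [mul_sum]
  refine sum_congr rfl fun k _ => ?_
  have h := card_disjoint_families (X := Fin n) (m k)
  rw [Fintype.card_fin] at h
  rw [← h]
  have : (∏ τ, ((m k τ).factorial : ℚ)) ≠ 0 :=
    prod_ne_zero_iff.2 fun τ _ => by exact_mod_cast (m k τ).factorial_ne_zero
  push_cast
  field_simp

end LabelledMap.Corners

/-! ### The networks of mutually tangent disks as maps -/

section HalfEdges

variable {n : ℕ}

/-- The disk from which a half-edge leads away. -/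
def source (h : Tangency n × Bool) : Fin n := if h.2 then h.1.1.2 else h.1.1.1

/-- The disk to which a half-edge leads. -/
def target (h : Tangency n × Bool) : Fin n := if h.2 then h.1.1.1 else h.1.1.2

/-- The half-edge `j → s j i` that follows `i → j` if `s j` is the cyclic order around `j`. -/
def nextOf (s : Fin n → Fin n → Fin n) (h : Tangency n × Bool) : Tangency n × Bool :=
  if hne : target h ≠ s (target h) (source h) then halfEdge _ _ hne else h

/-- The half-edge before a given one at a trivalent vertex. -/
def prevOf (s : Fin n → Fin n → Fin n) (h : Tangency n × Bool) : Tangency n × Bool :=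
  nextOf s (nextOf s h)

/-- From here on the geometry enters only through the table `s`. The default branch of `nextOf` is
not reached, because a successor around `j` is never `j`. -/
theorem diskNetwork_next (D : Fin n → Disk) (x : Fin n → ℤ) (s : Fin n → Fin n → Fin n)
    (hs : ∀ j i (h : i ≠ j), (successor D j i h).1 = s j i) :
    (diskNetwork D x).next = nextOf s := by
  have aux : ∀ (i j : Fin n) (h : i ≠ j), halfEdge j (successor D j i h).1
      (successor D j i h).2.symm = if hne : j ≠ s j i then halfEdge j (s j i) hne
        else halfEdge i j h := by
    intro i j h
    have h1 := hs j i h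
    have h2 := (successor D j i h).2
    rw [dif_pos (by rw [← h1]; exact h2.symm)]
    congr 1
  funext ⟨e, b⟩
  cases b
  · refine (aux e.1.1 e.1.2 e.2.ne).trans ?_
    simp only [nextOf, target, source, Bool.false_eq_true, if_false]
    congr 1
    funext _
    unfold halfEdge
    rw [dif_pos e.2]
    rfl
  · refine (aux e.1.2 e.1.1 e.2.ne').trans ?_
    simp only [nextOf, target, source, if_true]
    congr 1
    funext _
    unfold halfEdge
    rw [dif_neg e.2.not_gt]
    rfl

/-- The opposite half-edge. -/
def otherHalf (h : Tangency n × Bool) : Tangency n × Bool := (h.1, !h.2)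

end HalfEdges

theorem otherHalf_otherHalf {n : ℕ} (h : Tangency n × Bool) : otherHalf (otherHalf h) = h := by
  obtain ⟨e, _ | _⟩ := h <;> rfl

theorem Nat.card_quot_eq {X : Type*} {r : X → X → Prop} {m : ℕ} (c : X → Fin m)
    (hsurj : Function.Surjective c) (hr : ∀ x y, r x y → c x = c y)
    (hinj : ∀ x y, c x = c y → Quot.mk r x = Quot.mk r y) : Nat.card (Quot r) = m := by
  rw [Nat.card_congr (Equiv.ofBijective (Quot.lift c hr) ⟨?_, ?_⟩), Nat.card_fin]
  · intro q q'
    induction q using Quot.ind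
    induction q' using Quot.ind
    exact hinj _ _
  · intro i
    obtain ⟨x, rfl⟩ := hsurj i
    exact ⟨Quot.mk _ x, rfl⟩

theorem Nat.card_quot_orbits {X : Type*} (f : X → X) {m : ℕ} (c : X → Fin m)
    (hsurj : Function.Surjective c) (hf : ∀ x, c (f x) = c x)
    (horb : ∀ x y, c x = c y → y = x ∨ y = f x ∨ y = f (f x)) :
    Nat.card (Quot fun x y => f x = y) = m := by
  have hstep : ∀ x, (Quot.mk (fun x y => f x = y) x) = Quot.mk _ (f x) := fun x => Quot.sound rfl
  refine Nat.card_quot_eq c hsurj (fun x y h => by rw [← h, hf]) fun x y h => ?_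
  rcases horb x y h with rfl | rfl | rfl
  · rfl
  · exact hstep x
  · rw [← hstep, ← hstep]

section Trivalent

variable {n : ℕ} (D : Fin n → Disk) (x : Fin n → ℕ)

/-- The network of disks that carry natural numbers. -/
noncomputable abbrev natNetwork : LabelledMap := diskNetwork D fun i => (x i : ℤ)

theorem natNetwork_label (h : Tangency n × Bool) :
    (natNetwork D x).label h.1 = x (source h) + x (target h) := by
  obtain ⟨e, _ | _⟩ := h
  · simp only [natNetwork, diskNetwork, source, target, Bool.false_eq_true, if_false]
    omega
  · simp only [natNetwork, diskNetwork, source, target, if_true]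
    omega

/-- The cyclic orders `s` around the disks fit together to trivalent vertices. -/
structure IsTrivalent (s : Fin n → Fin n → Fin n) : Prop where
  source_next : ∀ h, source (nextOf s h) = target h
  cube : ∀ h, nextOf s (nextOf s (nextOf s h)) = h
  ne_otherHalf : ∀ h, nextOf s h ≠ otherHalf h
  ne_self : ∀ h, nextOf s h ≠ h

variable {D x} {s : Fin n → Fin n → Fin n}

theorem IsTrivalent.target_next_next (ht : IsTrivalent s) (h : Tangency n × Bool) :
    target (nextOf s (nextOf s h)) = source h := by
  rw [← ht.source_next, ht.cube]

theorem natNetwork_not_onCircle (hs : (natNetwork D x).next = nextOf s) (ht : IsTrivalent s)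
    (h : Tangency n × Bool) : ¬ (natNetwork D x).OnCircle h := by
  intro hc
  have := hc.1
  rw [hs] at this
  exact ht.ne_otherHalf h this

/-- If the half-edge leads from `i` to `j` and `k` is the third disk at the vertex, the turning
number is half of (x i + x j) + (x j + x k) - (x k + x i), which is x j. -/
theorem natNetwork_turning (hs : (natNetwork D x).next = nextOf s) (ht : IsTrivalent s)
    (h : Tangency n × Bool) :
    (natNetwork D x).turning h = x (target h) := by
  have h1 := ht.source_next h
  have h2 := ht.source_next (nextOf s h)
  have h3 := ht.target_next_next h
  unfold LabelledMap.turning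
  rw [if_neg (natNetwork_not_onCircle hs ht h), hs]
  rw [natNetwork_label D x h, natNetwork_label D x (nextOf s h),
    natNetwork_label D x (nextOf s (nextOf s h)), h1, h2, h3]
  omega

theorem natNetwork_atAdmissibleVertex (hs : (natNetwork D x).next = nextOf s) (ht : IsTrivalent s)
    (h : Tangency n × Bool) :
    (natNetwork D x).AtAdmissibleVertex h := by
  have h1 := ht.source_next h
  have h2 := ht.source_next (nextOf s h)
  have h3 := ht.target_next_next h
  unfold LabelledMap.AtAdmissibleVertex
  rw [hs]
  rw [natNetwork_label D x h, natNetwork_label D x (nextOf s h),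
    natNetwork_label D x (nextOf s (nextOf s h)), h1, h2, h3]
  refine ⟨ht.ne_self h, ht.cube h, ⟨x (source h) + x (target h) + x (target (nextOf s h)), ?_⟩, ?_⟩ <;> omega

/-- The corners of a network of trivalent vertices: the strands that turn from `i → j` to the next
half-edge go around the disk `j`. -/
def natCorners (hs : (natNetwork D x).next = nextOf s) (ht : IsTrivalent s) :
    (natNetwork D x).Corners where
  prev := prevOf s
  size h := x (target h)
  next_prev h := by rw [hs]; exact ht.cube h
  prev_next h := by rw [hs]; exact ht.cube h
  size_add h := by
    exact (congrArg (x · + x (target h)) (ht.target_next_next h)).trans (natNetwork_label D x h).symm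
  size_le h := (natNetwork_turning hs ht h).ge
  two_valent h hh := (hh (natNetwork_turning hs ht h).symm).elim

end Trivalent

/-! ### Two disks -/

section Two

def twoEdge : Tangency 2 := ⟨(0, 1), by decide⟩

theorem tangency_two (e : Tangency 2) : e = twoEdge := by
  revert e
  decide

theorem nextOf_two : nextOf (fun _ i : Fin 2 => i) = otherHalf := by
  decide

variable (D : Fin 2 → Disk) (x : Fin 2 → ℤ)

theorem twoNetwork_next : (diskNetwork D x).next = otherHalf := by
  rw [diskNetwork_next D x (fun _ i => i)]
  · exact nextOf_two
  · intro j i h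
    have := (successor D j i h).2
    omega

theorem twoNetwork_onCircle (h : Tangency 2 × Bool) : (diskNetwork D x).OnCircle h := by
  unfold LabelledMap.OnCircle
  rw [twoNetwork_next]
  exact ⟨rfl, otherHalf_otherHalf h⟩

theorem twoNetwork_isSpinNetwork : (diskNetwork D x).IsSpinNetwork := by
  refine ⟨fun h => Or.inl (twoNetwork_onCircle D x h), ?_⟩
  unfold LabelledMap.IsPlanar
  have h1 : Nat.card (Quot fun h h' : Tangency 2 × Bool => otherHalf h = h') = 1 :=
    Nat.card_quot_orbits otherHalf (fun _ => 0) (fun i => ⟨(twoEdge, false), (Fin.fin_one_eq_zero i).symm⟩)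
      (fun _ => rfl) (by decide)
  have h2 : Nat.card (Quot fun h h' : Tangency 2 × Bool => otherHalf (otherHalf h) = h') = 2 :=
    Nat.card_quot_orbits (fun h => otherHalf (otherHalf h)) source (by decide) (by decide) (by decide)
  have h3 : Nat.card (Quot fun h h' : Tangency 2 × Bool => otherHalf h = h' ∨ otherHalf h = h') = 1 := by
    simp only [or_self]
    exact h1
  rw [twoNetwork_next]
  change Nat.card (Quot fun h h' : Tangency 2 × Bool => otherHalf h = h') +
    Nat.card (Quot fun h h' : Tangency 2 × Bool => otherHalf (otherHalf h) = h') =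
    Fintype.card (Tangency 2) +
      2 * Nat.card (Quot fun h h' : Tangency 2 × Bool => otherHalf h = h' ∨ otherHalf h = h')
  rw [h1, h2, h3]
  decide

/-- All strands are attributed to the corner of one of the two half-edges. -/
noncomputable def twoCorners : (diskNetwork D x).Corners where
  prev := otherHalf
  size h := if h.2 then 0 else (x 0 + x 1).toNat
  next_prev h := by rw [twoNetwork_next]; exact otherHalf_otherHalf h
  prev_next h := by rw [twoNetwork_next]; exact otherHalf_otherHalf h
  size_add h := by
    obtain ⟨e, b⟩ := h
    obtain rfl := tangency_two e
    cases b <;> simp [otherHalf, diskNetwork, twoEdge]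
  size_le h := by
    unfold LabelledMap.turning
    rw [if_pos (twoNetwork_onCircle D x h)]
    obtain ⟨e, b⟩ := h
    obtain rfl := tangency_two e
    cases b <;> simp [diskNetwork, twoEdge]
  two_valent h _ := by
    rw [twoNetwork_next]
    exact ⟨otherHalf_otherHalf h, rfl⟩

theorem twoCorners_balanced : (twoCorners D x).Balanced := by
  intro a b ha hb
  refine even_sum (f := fun e => (a (e, false) + a ((twoCorners D x).prev (e, false))) *
    (b (e, true) + b ((twoCorners D x).prev (e, false)))) fun e _ => ?_
  -- Here the predecessor of `(e, false)` is `(e, true)`, so the second factor is `2 * b (e, true)`.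
  exact Even.mul_left ⟨b (e, true), rfl⟩ _

theorem twoNetwork_evaluation : (diskNetwork D x).evaluation =
    (-1) ^ (x 0 + x 1).toNat * (((x 0 + x 1).toNat + 1 : ℕ) : ℚ) := by
  -- Each of the two half-edges alone is a cycle set. Since all strands are attributed to the corner
  -- of `false`, the other cycle carries none.
  rw [(twoCorners D x).evaluation_eq_sum_cycles (twoCorners_balanced D x) (T := Bool)
    (fun τ h => h.2 == τ) ?_ ?_ ?_ {0} (fun _ τ => if τ then 0 else (x 0 + x 1).toNat) ?_ ?_]
  · have hlabel : ∏ e, (((diskNetwork D x).label e).factorial : ℚ) =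
        ((x 0 + x 1).toNat.factorial : ℚ) := by
      change ∏ e : Tangency 2, (((diskNetwork D x).label e).factorial : ℚ) = _
      rw [Fintype.prod_eq_single twoEdge fun e h => (h (tangency_two e)).elim]
      rfl
    have hsize : ∏ h, (((twoCorners D x).size h).factorial : ℚ) =
        ((x 0 + x 1).toNat.factorial : ℚ) := by
      change ∏ h : Tangency 2 × Bool, (((twoCorners D x).size h).factorial : ℚ) = _
      rw [Fintype.prod_prod_type, Fintype.prod_eq_single twoEdge
        fun e h => (h (tangency_two e)).elim]
      simp [twoCorners]
    have hne : ((x 0 + x 1).toNat.factorial : ℚ) ≠ 0 := by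
      exact_mod_cast Nat.factorial_ne_zero _
    rw [hlabel, hsize]
    simp only [sum_singleton, Fintype.prod_bool, Fintype.sum_bool, if_true, Bool.false_eq_true,
      if_false, Nat.factorial_zero, zero_add, Nat.cast_one, one_mul, Nat.factorial_succ]
    push_cast
    field_simp
  · intro τ τ' h
    have := congrFun h (twoEdge, τ)
    simpa using this
  · intro τ h
    have := congrFun h (twoEdge, τ)
    simp at this
  · intro v
    change ((∀ h, ¬ (v h ∧ v (otherHalf h))) ∧ ∀ h, (v h || v (otherHalf h)) = (v (otherHalf h) || v (otherHalf (otherHalf h)))) ↔ _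
    constructor
    · rintro ⟨h1, -⟩
      have h1 := h1 (twoEdge, false)
      simp only [otherHalf, Bool.not_false] at h1
      rcases hf : v (twoEdge, false) with _ | _ <;> rcases ht : v (twoEdge, true) with _ | _
      · left
        funext ⟨e, b⟩
        obtain rfl := tangency_two e
        cases b <;> simp [hf, ht]
      · refine Or.inr ⟨true, ?_⟩
        funext ⟨e, b⟩
        obtain rfl := tangency_two e
        cases b <;> simp [hf, ht]
      · refine Or.inr ⟨false, ?_⟩
        funext ⟨e, b⟩
        obtain rfl := tangency_two e
        cases b <;> simp [hf, ht]
      · exact (h1 ⟨hf, ht⟩).elim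
    · rintro (rfl | ⟨τ, rfl⟩)
      · simp
      · refine ⟨fun h => ?_, fun h => ?_⟩
        · cases h.2 <;> cases τ <;> simp [otherHalf]
        · simp only [otherHalf, Bool.not_not]
          rw [Bool.or_comm]
  · simp
  · intro M
    simp only [mem_singleton, exists_eq_left]
    constructor
    · intro h
      have h1 := h (twoEdge, false)
      have h2 := h (twoEdge, true)
      simp [sum_filter, twoCorners] at h1 h2
      funext τ
      cases τ <;> simp [h1, h2]
    · rintro rfl ⟨e, b⟩
      cases b <;> simp [sum_filter, twoCorners]

end Two

/-- The bounds suffice for networks in which every vertex is the initial one or adjacent to it: turn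
at the first vertex, cross an edge, turn at the second. They make the hypothesis decidable. -/
theorem Nat.card_quot_connected {X : Type*} (f g : X → X) (x₀ : X)
    (h : ∀ x, ∃ i < 3, ∃ j < 2, ∃ k < 3, x = f^[i] (g^[j] (f^[k] x₀))) :
    Nat.card (Quot fun x y => f x = y ∨ g x = y) = 1 := by
  have hf : ∀ i x, Quot.mk (fun x y => f x = y ∨ g x = y) (f^[i] x) = Quot.mk _ x := by
    intro i
    induction i with
    | zero => exact fun _ => rfl
    | succ i ih =>
      intro x
      rw [Function.iterate_succ_apply, ih]
      exact (Quot.sound (r := fun x y => f x = y ∨ g x = y) (Or.inl rfl)).symm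
  have hg : ∀ i x, Quot.mk (fun x y => f x = y ∨ g x = y) (g^[i] x) = Quot.mk _ x := by
    intro i
    induction i with
    | zero => exact fun _ => rfl
    | succ i ih =>
      intro x
      rw [Function.iterate_succ_apply, ih]
      exact (Quot.sound (r := fun x y => f x = y ∨ g x = y) (Or.inr rfl)).symm
  have hall : ∀ x, Quot.mk (fun x y => f x = y ∨ g x = y) x = Quot.mk _ x₀ := by
    intro x
    obtain ⟨i, -, j, -, k, -, rfl⟩ := h x
    rw [hf, hg, hf]
  exact Nat.card_quot_eq (fun _ => 0) (fun i => ⟨x₀, (Fin.fin_one_eq_zero i).symm⟩)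
    (fun _ _ _ => rfl) fun x y _ => (hall x).trans (hall y).symm

/-! ### Three disks -/

section Three

/-- The third of three disks. -/
def third (j i : Fin 3) : Fin 3 := -(j + i)

theorem isTrivalent_third : IsTrivalent third := by
  constructor <;> decide

namespace Three

def e01 : Tangency 3 := ⟨(0, 1), by decide⟩

def e02 : Tangency 3 := ⟨(0, 2), by decide⟩

def e12 : Tangency 3 := ⟨(1, 2), by decide⟩

end Three

open Three in
theorem prevOf_third :
    prevOf third (e01, false) = (e02, true) ∧ prevOf third (e01, true) = (e12, true) ∧ prevOf third (e02, false) = (e01, true) ∧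
      prevOf third (e02, true) = (e12, false) ∧ prevOf third (e12, false) = (e01, false) ∧
      prevOf third (e12, true) = (e02, false) := by
  decide

/-- The half-edges `i → i + 1` modulo 3 surround one of the two ideal triangles, the remaining ones
the other. -/
def side (h : Tangency 3 × Bool) : Fin 2 := if target h = source h + 1 then 0 else 1

theorem tangency_three : (univ : Finset (Tangency 3)) =
    {Three.e01, Three.e02, Three.e12} := by
  decide

theorem prod_tangency_three {M : Type*} [CommMonoid M] (f : Tangency 3 → M) :
    ∏ e, f e = f Three.e01 * f Three.e02 * f Three.e12 := by
  rw [tangency_three, prod_insert (by decide), prod_insert (by decide), prod_singleton, mul_assoc]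

/-- There is no fourth index, so the order condition in `Follows` is vacuous and the successor is
forced to be the remaining disk. -/
theorem successor_three (D : Fin 3 → Disk) (j i : Fin 3) (h : i ≠ j) :
    (successor D j i h).1 = third j i := by
  have hex : ∃ k, Follows D j i k := by
    refine ⟨third j i, ?_, ?_, ?_⟩
    · revert i j; decide
    · revert i j; decide
    · intro l h1 h2 h3
      exact absurd h3 (by revert i j l; decide)
  unfold successor
  rw [dif_pos hex]
  have h1 := hex.choose_spec.1
  have h2 := hex.choose_spec.2.1
  simp only
  generalize hex.choose = k at h1 h2
  clear hex
  revert i j k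
  decide

variable (D : Fin 3 → Disk) (x : Fin 3 → ℕ)

theorem threeNetwork_next : (natNetwork D x).next = nextOf third :=
  diskNetwork_next D _ third (successor_three D)

theorem threeNetwork_isSpinNetwork : (natNetwork D x).IsSpinNetwork := by
  refine ⟨fun h => Or.inr (natNetwork_atAdmissibleVertex (threeNetwork_next D x)
    isTrivalent_third h), ?_⟩
  unfold LabelledMap.IsPlanar
  rw [threeNetwork_next]
  have h1 : Nat.card (Quot fun h h' : Tangency 3 × Bool => nextOf third h = h') = 2 :=
    Nat.card_quot_orbits (nextOf third) side (by decide) (by decide) (by decide)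
  have h2 : Nat.card (Quot fun h h' : Tangency 3 × Bool => nextOf third (otherHalf h) = h') = 3 :=
    Nat.card_quot_orbits (fun h => nextOf third (otherHalf h)) source (by decide) (by decide)
      (by decide)
  have h3 : Nat.card (Quot fun h h' : Tangency 3 × Bool =>
      nextOf third h = h' ∨ otherHalf h = h') = 1 := by
    refine Nat.card_quot_connected _ _ (Three.e01, false) ?_
    decide
  change Nat.card (Quot fun h h' : Tangency 3 × Bool => nextOf third h = h') +
    Nat.card (Quot fun h h' : Tangency 3 × Bool => nextOf third (otherHalf h) = h') =
    Fintype.card (Tangency 3) + 2 * Nat.card (Quot fun h h' : Tangency 3 × Bool =>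
      nextOf third h = h' ∨ otherHalf h = h')
  rw [h1, h2, h3]
  decide

noncomputable abbrev threeCorners : (natNetwork D x).Corners :=
  natCorners (threeNetwork_next D x) isTrivalent_third

/-- Each disk has one corner in each of the two regions. The three matching conditions force the two
corners of a disk to carry equal numbers, and the two summands here belong to such a pair. -/
theorem even_crossings_three (b : Tangency 3 × Bool → ℤ)
    (hb : ∀ h, b h + b (prevOf third h) =
      b (otherHalf h) + b (prevOf third (otherHalf h))) (e : Tangency 3) :
    Even (b (e, true) + b (prevOf third (e, false))) := by
  obtain ⟨p1, p2, p3, p4, p5, p6⟩ := prevOf_third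
  have h1 := hb (Three.e01, false)
  have h2 := hb (Three.e02, false)
  have h3 := hb (Three.e12, false)
  simp only [otherHalf, Bool.not_false] at h1 h2 h3
  rw [p1, p2] at h1
  rw [p3, p4] at h2
  rw [p5, p6] at h3
  have he : e ∈ (univ : Finset (Tangency 3)) := mem_univ e
  simp only [tangency_three, mem_insert, mem_singleton] at he
  rcases he with rfl | rfl | rfl
  · rw [p1]
    exact ⟨b (Three.e01, true), by omega⟩
  · rw [p3]
    exact ⟨b (Three.e01, true), by omega⟩
  · rw [p5]
    exact ⟨b (Three.e01, false), by omega⟩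

theorem threeCorners_balanced : (threeCorners D x).Balanced := fun _ b _ hb =>
  even_sum _ fun e _ => Even.mul_left (even_crossings_three b hb e) _

theorem forall_halfEdge_three {P : Tangency 3 × Bool → Prop} : (∀ h, P h) ↔
    P (Three.e01, false) ∧ P (Three.e01, true) ∧
    P (Three.e02, false) ∧ P (Three.e02, true) ∧
    P (Three.e12, false) ∧ P (Three.e12, true) := by
  constructor
  · exact fun h => ⟨h _, h _, h _, h _, h _, h _⟩
  · rintro ⟨h1, h2, h3, h4, h5, h6⟩ ⟨e, b⟩
    have he : e ∈ (univ : Finset (Tangency 3)) := mem_univ e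
    simp only [tangency_three, mem_insert, mem_singleton] at he
    rcases he with rfl | rfl | rfl <;> cases b <;> assumption

/-- The hypotheses stand between the quantifiers so that `decide` discards impossible values early.
-/
theorem isCycleSet_three_aux : ∀ p q r s : Bool, (p && r) = false → (q && s) = false →
    (p || r) = (q || s) → ∀ t u : Bool, (t && q) = false → (r && u) = false →
    (t || q) = (r || u) → (u && p) = false → (s && t) = false → (u || p) = (s || t) →
    [p, q, t, r, u, s] ∈ [[false, false, false, false, false, false],
      [false, true, false, true, false, false], [true, false, false, false, false, true],
      [false, false, true, false, true, false]] := by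
  decide

def diskCycle (τ : Fin 3) (h : Tangency 3 × Bool) : Bool := decide (target h = τ)

theorem eq_diskCycle (v : Tangency 3 × Bool → Bool)
    (h1 : ∀ h, (v h && v (prevOf third h)) = false)
    (h2 : ∀ h, (v h || v (prevOf third h)) =
      (v (otherHalf h) || v (prevOf third (otherHalf h)))) :
    v = (fun _ => false) ∨ ∃ τ, v = diskCycle τ := by
  obtain ⟨p1, p2, p3, p4, p5, p6⟩ := prevOf_third
  have d1 := h1 (Three.e01, false)
  have d2 := h1 (Three.e01, true)
  have d3 := h1 (Three.e02, false)
  have d4 := h1 (Three.e02, true)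
  have d5 := h1 (Three.e12, false)
  have d6 := h1 (Three.e12, true)
  have c1 := h2 (Three.e01, false)
  have c2 := h2 (Three.e02, false)
  have c3 := h2 (Three.e12, false)
  simp only [otherHalf, Bool.not_false] at c1 c2 c3
  rw [p1] at d1
  rw [p2] at d2
  rw [p3] at d3
  rw [p4] at d4
  rw [p5] at d5
  rw [p6] at d6
  rw [p1, p2] at c1
  rw [p3, p4] at c2
  rw [p5, p6] at c3
  have key := isCycleSet_three_aux _ _ _ _ d1 d2 c1 _ _ d3 d4 c2 d5 d6 c3
  simp only [List.mem_cons, List.cons.injEq, List.not_mem_nil, and_true, or_false] at key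
  rcases key with key | key | key | key
  · left
    exact funext (forall_halfEdge_three.2 key)
  · exact Or.inr ⟨0, funext (forall_halfEdge_three.2 key)⟩
  · exact Or.inr ⟨1, funext (forall_halfEdge_three.2 key)⟩
  · exact Or.inr ⟨2, funext (forall_halfEdge_three.2 key)⟩

theorem isCycleSet_three (v : Tangency 3 × Bool → Bool) : (threeCorners D x).IsCycleSet v ↔
    v = (fun _ => false) ∨ ∃ τ, v = diskCycle τ := by
  constructor
  · rintro ⟨h1, h2⟩
    refine eq_diskCycle v (fun h => ?_) h2
    rw [Bool.eq_false_iff, ne_eq, Bool.and_eq_true]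
    exact h1 h
  · have hd : ∀ τ, (∀ h : Tangency 3 × Bool,
        ¬ (diskCycle τ h ∧ diskCycle τ (prevOf third h))) ∧
        ∀ h : Tangency 3 × Bool, (diskCycle τ h || diskCycle τ (prevOf third h)) =
          (diskCycle τ (otherHalf h) ||
            diskCycle τ (prevOf third (otherHalf h))) := by
      decide
    rintro (rfl | ⟨τ, rfl⟩)
    · exact ⟨by simp, by simp⟩
    · exact hd τ

theorem threeNetwork_evaluation : (natNetwork D x).evaluation =
    (-1) ^ (x 0 + x 1 + x 2) * (((x 0).factorial * (x 1).factorial * (x 2).factorial *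
      (x 0 + x 1 + x 2 + 1).factorial : ℕ) : ℚ) /
      (((x 0 + x 1).factorial * (x 1 + x 2).factorial * (x 2 + x 0).factorial : ℕ) : ℚ) := by
  rw [(threeCorners D x).evaluation_eq_sum_cycles (threeCorners_balanced D x) diskCycle ?_ ?_
    (isCycleSet_three D x) {0} (fun _ => x) ?_ ?_]
  · have hlabel : ∏ e, (((natNetwork D x).label e).factorial : ℚ) =
        ((x 0 + x 1).factorial : ℚ) * ((x 0 + x 2).factorial : ℚ) *
          ((x 1 + x 2).factorial : ℚ) :=
      (prod_tangency_three fun e => (((natNetwork D x).label e).factorial : ℚ))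
    have hsize : ∏ h, (((threeCorners D x).size h).factorial : ℚ) =
        ((x 0).factorial : ℚ) ^ 2 * ((x 1).factorial : ℚ) ^ 2 * ((x 2).factorial : ℚ) ^ 2 := by
      change ∏ h : Tangency 3 × Bool, ((x (target h)).factorial : ℚ) = _
      rw [Fintype.prod_prod_type, prod_tangency_three]
      simp [target, Three.e01, Three.e02, Three.e12]
      ring
    have hne : ∀ n : ℕ, (n.factorial : ℚ) ≠ 0 := fun n => by
      exact_mod_cast Nat.factorial_ne_zero _
    have h0 := hne (x 0)
    have h1 := hne (x 1)
    have h2 := hne (x 2)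
    rw [hlabel, hsize, add_comm (x 2) (x 0)]
    simp only [sum_singleton, Fin.prod_univ_three, Fin.sum_univ_three]
    push_cast
    field_simp
  · intro τ τ' h
    have : ∀ τ τ', (∀ h, diskCycle τ h = diskCycle τ' h) → τ = τ' := by decide
    exact this τ τ' (congrFun h)
  · intro τ h
    have : ∀ τ, ∃ h, diskCycle τ h = true := by decide
    obtain ⟨h', hh⟩ := this τ
    rw [h] at hh
    cases hh
  · simp
  · intro M
    have hsum : ∀ h : Tangency 3 × Bool, ∑ τ with diskCycle τ h, M τ = M (target h) := by
      intro h
      simp [diskCycle, sum_filter]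
    simp only [mem_singleton, exists_eq_left]
    constructor
    · intro h
      funext i
      have : ∀ i, ∃ h : Tangency 3 × Bool, target h = i := by decide
      obtain ⟨h', rfl⟩ := this i
      rw [← hsum]
      exact (h h').symm
    · rintro rfl h
      exact hsum h

end Three

/-! ### Four disks -/

section Four

/-- The two possible systems of cyclic orders of the tangencies around four disks. -/
def cyclicOrder : Bool → Fin 4 → Fin 4 → Fin 4
  | true => ![![0, 2, 3, 1], ![3, 1, 0, 2], ![1, 3, 2, 0], ![2, 0, 1, 3]]
  | false => ![![0, 3, 1, 2], ![2, 1, 3, 0], ![3, 0, 2, 1], ![1, 2, 0, 3]]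

theorem isTrivalent_cyclicOrder (ε : Bool) : IsTrivalent (cyclicOrder ε) := by
  constructor <;> revert ε <;> decide

/-- The disk that does not touch the region of a half-edge. -/
def far (ε : Bool) (h : Tangency 4 × Bool) : Fin 4 :=
  cyclicOrder ε (target h) (cyclicOrder ε (target h) (source h))

/-- The half-edge whose corner belongs to the disk `i` and the region that does not touch `l`. -/
def corner (ε : Bool) (l i : Fin 4) : Tangency 4 × Bool :=
  if h : cyclicOrder ε i l ≠ i then halfEdge _ _ h else (⟨(0, 1), by decide⟩, false)

theorem corner_far : ∀ ε h, corner ε (far ε h) (target h) = h := by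
  decide

theorem corner_prevOf :
    ∀ ε h, corner ε (far ε h) (source h) = prevOf (cyclicOrder ε) h := by
  decide

theorem far_ne_target : ∀ ε h, far ε h ≠ target h := by
  decide

/-- The three pairs of opposite tangencies. -/
def pairIndex : Fin 4 → Fin 4 → Fin 3 :=
  ![![0, 0, 1, 2], ![0, 0, 2, 1], ![1, 2, 0, 0], ![2, 1, 0, 0]]

theorem exists_halfEdge_of_ne : ∀ ε, ∀ i j k l : Fin 4, i ≠ j → k ≠ i → k ≠ j → l ≠ i → l ≠ j →
    l ≠ k → ∃ h : Tangency 4 × Bool, (source h = i ∧ target h = j ∨ source h = j ∧ target h = i) ∧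
      far ε h = k ∧ far ε (otherHalf h) = l := by
  decide

theorem source_otherHalf {n : ℕ} (h : Tangency n × Bool) : source (otherHalf h) = target h := by
  obtain ⟨e, _ | _⟩ := h <;> rfl

theorem target_otherHalf {n : ℕ} (h : Tangency n × Bool) : target (otherHalf h) = source h := by
  obtain ⟨e, _ | _⟩ := h <;> rfl

theorem tangency_four : (univ : Finset (Tangency 4)) =
    {⟨(0, 1), by decide⟩, ⟨(0, 2), by decide⟩, ⟨(0, 3), by decide⟩, ⟨(1, 2), by decide⟩,
      ⟨(1, 3), by decide⟩, ⟨(2, 3), by decide⟩} := by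
  decide

theorem prod_tangency_four {M : Type*} [CommMonoid M] (f : Tangency 4 → M) :
    ∏ e, f e = f ⟨(0, 1), by decide⟩ * (f ⟨(0, 2), by decide⟩ * (f ⟨(0, 3), by decide⟩ *
      (f ⟨(1, 2), by decide⟩ * (f ⟨(1, 3), by decide⟩ * f ⟨(2, 3), by decide⟩)))) := by
  rw [tangency_four, prod_insert (by decide), prod_insert (by decide), prod_insert (by decide),
    prod_insert (by decide), prod_insert (by decide), prod_singleton]

theorem sum_tangency_four {M : Type*} [AddCommMonoid M] (f : Tangency 4 → M) :
    ∑ e, f e = f ⟨(0, 1), by decide⟩ + (f ⟨(0, 2), by decide⟩ + (f ⟨(0, 3), by decide⟩ +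
      (f ⟨(1, 2), by decide⟩ + (f ⟨(1, 3), by decide⟩ + f ⟨(2, 3), by decide⟩)))) := by
  rw [tangency_four, sum_insert (by decide), sum_insert (by decide), sum_insert (by decide),
    sum_insert (by decide), sum_insert (by decide), sum_singleton]

/-- The integral solutions of the matching conditions at the edges of a tetrahedron. -/
theorem exists_decomposition (A : Fin 4 → Fin 4 → ℤ)
    (hA : ∀ i j k l, i ≠ j → k ≠ i → k ≠ j → l ≠ i → l ≠ j → l ≠ k →
      A k i + A k j = A l i + A l j) :
    ∃ (t : Fin 4 → ℤ) (q : Fin 3 → ℤ), ∀ l i, l ≠ i → A l i = t i + q (pairIndex l i) := by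
  have h01 := hA 0 1 2 3 (by decide) (by decide) (by decide) (by decide) (by decide) (by decide)
  have h02 := hA 0 2 1 3 (by decide) (by decide) (by decide) (by decide) (by decide) (by decide)
  have h03 := hA 0 3 1 2 (by decide) (by decide) (by decide) (by decide) (by decide) (by decide)
  have h12 := hA 1 2 0 3 (by decide) (by decide) (by decide) (by decide) (by decide) (by decide)
  have h13 := hA 1 3 0 2 (by decide) (by decide) (by decide) (by decide) (by decide) (by decide)
  have h23 := hA 2 3 0 1 (by decide) (by decide) (by decide) (by decide) (by decide) (by decide)
  -- Normalized by `q 0 = 0`: then `t i` is the corner of `i` with pair index 0, and the other two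
  -- values of `q` are read off at the disk 0.
  refine ⟨![A 1 0, A 0 1, A 3 2, A 2 3], ![0, A 2 0 - A 1 0, A 3 0 - A 1 0], ?_⟩
  intro l i hne
  fin_cases l <;> fin_cases i <;> simp [pairIndex] at hne ⊢ <;> omega

/-- Corners are indexed by their disk and by the disk that their region does not touch. By
`exists_decomposition` the sum becomes a bilinear form in the parameters of `a` and `b`, all of
whose coefficients are even. -/
theorem even_crossings_four (ε : Bool) (a b : Tangency 4 × Bool → ℤ)
    (ha : ∀ h, a h + a (prevOf (cyclicOrder ε) h) =
      a (otherHalf h) + a (prevOf (cyclicOrder ε) (otherHalf h)))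
    (hb : ∀ h, b h + b (prevOf (cyclicOrder ε) h) =
      b (otherHalf h) + b (prevOf (cyclicOrder ε) (otherHalf h))) :
    Even (∑ e : Tangency 4, (a (e, false) + a (prevOf (cyclicOrder ε) (e, false))) *
      (b (e, true) + b (prevOf (cyclicOrder ε) (e, false)))) := by
  have hmatch : ∀ a : Tangency 4 × Bool → ℤ, (∀ h, a h + a (prevOf (cyclicOrder ε) h) =
      a (otherHalf h) + a (prevOf (cyclicOrder ε) (otherHalf h))) →
      ∀ i j k l, i ≠ j → k ≠ i → k ≠ j → l ≠ i → l ≠ j → l ≠ k →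
        a (corner ε k i) + a (corner ε k j) = a (corner ε l i) + a (corner ε l j) := by
    intro a ha i j k l h1 h2 h3 h4 h5 h6
    obtain ⟨h, hij, rfl, rfl⟩ := exists_halfEdge_of_ne ε i j k l h1 h2 h3 h4 h5 h6
    have e3 := corner_far ε (otherHalf h)
    have e4 := corner_prevOf ε (otherHalf h)
    rw [target_otherHalf] at e3
    rw [source_otherHalf] at e4
    rcases hij with ⟨rfl, rfl⟩ | ⟨rfl, rfl⟩ <;>
      rw [corner_far, corner_prevOf, e3, e4] <;> linarith [ha h]
  have hfar : ∀ ε, ∀ i j k l : Fin 4, ∀ h : i < j, k ≠ i → k ≠ j → l ≠ i → l ≠ j → l ≠ k →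
      far ε (⟨(i, j), h⟩, false) = k ∧ far ε (⟨(i, j), h⟩, true) = l ∨
      far ε (⟨(i, j), h⟩, false) = l ∧ far ε (⟨(i, j), h⟩, true) = k := by
    decide
  have hterm : ∀ i j k l : Fin 4, ∀ h : i < j, k ≠ i → k ≠ j → l ≠ i → l ≠ j → l ≠ k →
      (a (⟨(i, j), h⟩, false) + a (prevOf (cyclicOrder ε) (⟨(i, j), h⟩, false))) *
        (b (⟨(i, j), h⟩, true) + b (prevOf (cyclicOrder ε) (⟨(i, j), h⟩, false))) =
      (a (corner ε k i) + a (corner ε k j)) * (b (corner ε k i) + b (corner ε l i)) := by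
    intro i j k l h h2 h3 h4 h5 h6
    have hm := hmatch a ha i j k l h.ne h2 h3 h4 h5 h6
    have e1 := corner_far ε (⟨(i, j), h⟩, false)
    have e2 := corner_prevOf ε (⟨(i, j), h⟩, false)
    have e3 := corner_far ε (⟨(i, j), h⟩, true)
    rw [← e2]
    nth_rewrite 1 [← e1]
    nth_rewrite 1 [← e3]
    change (a (corner ε _ j) + a (corner ε _ i)) * (b (corner ε _ i) + b (corner ε _ i)) = _
    -- The orientation decides which of the two regions lies on the first side of the edge; the
    -- matching condition makes the product independent of this.
    rcases hfar ε i j k l h h2 h3 h4 h5 h6 with ⟨f1, f2⟩ | ⟨f1, f2⟩ <;> rw [f1, f2]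
    · ring
    · rw [hm]
      ring
  obtain ⟨t, q, hA⟩ := exists_decomposition (fun l i => a (corner ε l i)) (hmatch a ha)
  obtain ⟨s, r, hB⟩ := exists_decomposition (fun l i => b (corner ε l i)) (hmatch b hb)
  have hterm' : ∀ i j k l : Fin 4, ∀ h : i < j, k ≠ i → k ≠ j → l ≠ i → l ≠ j → l ≠ k →
      (a (⟨(i, j), h⟩, false) + a (prevOf (cyclicOrder ε) (⟨(i, j), h⟩, false))) *
        (b (⟨(i, j), h⟩, true) + b (prevOf (cyclicOrder ε) (⟨(i, j), h⟩, false))) =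
      (t i + q (pairIndex k i) + (t j + q (pairIndex k j))) *
        (s i + r (pairIndex k i) + (s i + r (pairIndex l i))) := by
    intro i j k l h h2 h3 h4 h5 h6
    rw [hterm i j k l h h2 h3 h4 h5 h6, ← hA k i h2, ← hA k j h3, ← hB k i h2, ← hB l i h4]
  rw [sum_tangency_four,
    hterm' 0 1 2 3 (by decide) (by decide) (by decide) (by decide) (by decide) (by decide),
    hterm' 0 2 1 3 (by decide) (by decide) (by decide) (by decide) (by decide) (by decide),
    hterm' 0 3 1 2 (by decide) (by decide) (by decide) (by decide) (by decide) (by decide),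
    hterm' 1 2 0 3 (by decide) (by decide) (by decide) (by decide) (by decide) (by decide),
    hterm' 1 3 0 2 (by decide) (by decide) (by decide) (by decide) (by decide) (by decide),
    hterm' 2 3 0 1 (by decide) (by decide) (by decide) (by decide) (by decide) (by decide)]
  change Even ((t 0 + q 1 + (t 1 + q 2)) * (s 0 + r 1 + (s 0 + r 2)) +
    ((t 0 + q 0 + (t 2 + q 2)) * (s 0 + r 0 + (s 0 + r 2)) +
    ((t 0 + q 0 + (t 3 + q 1)) * (s 0 + r 0 + (s 0 + r 1)) +
    ((t 1 + q 0 + (t 2 + q 1)) * (s 1 + r 0 + (s 1 + r 1)) +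
    ((t 1 + q 0 + (t 3 + q 2)) * (s 1 + r 0 + (s 1 + r 2)) +
    (t 2 + q 1 + (t 3 + q 2)) * (s 2 + r 1 + (s 2 + r 2)))))))
  -- Half of the expanded bilinear form.
  exact ⟨(3 * t 0 + t 1 + 2 * q 1 + 2 * q 2 + t 2 + 2 * q 0 + t 3) * s 0 + (t 0 + t 1 + 2 * q
        1 + q 2 + t 3 + q 0 + t 2) * r 1 + (t 0 + t 1 + q 1 + 2 * q 2 + t 2 + q 0 + t 3) * r
        2 + (t 0 + t 2 + 2 * q 0 + q 2 + t 3 + q 1 + t 1) * r 0 + (2 * t 1 + t 2 + 2 * q 0 +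
        q 1 + t 3 + q 2) * s 1 + (t 2 + t 3 + q 1 + q 2) * s 2, by ring⟩

/-- The cycles of the tetrahedron: the triangles around the disks, and the quadrilaterals, each of
which avoids a pair of opposite edges. -/
def tetrahedronCycle (ε : Bool) (τ : Fin 4 ⊕ Fin 3) (h : Tangency 4 × Bool) : Bool :=
  τ.elim (fun i => decide (target h = i)) fun q => decide (pairIndex (far ε h) (target h) = q)

set_option synthInstance.maxHeartbeats 400000 in
set_option synthInstance.maxSize 2000 in
-- The eight solutions are the empty set, the four triangles and the three quadrilaterals. Again the
-- hypotheses are interleaved so that the search is pruned.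
theorem cycle_table_aux : ∀ v20 v21 v30 v31 : Bool,
    (v20 && v21) = false → (v30 && v31) = false →
    (v20 || v21) = (v30 || v31) → ∀ v10 v12 v32 : Bool,
    (v10 && v12) = false → (v30 && v32) = false →
    (v10 || v12) = (v30 || v32) → ∀ v13 v23 : Bool,
    (v10 && v13) = false → (v20 && v23) = false →
    (v10 || v13) = (v20 || v23) → ∀ v01 v02 : Bool,
    (v01 && v02) = false → (v31 && v32) = false →
    (v01 || v02) = (v31 || v32) → ∀ v03 : Bool,
    (v01 && v03) = false → (v21 && v23) = false →
    (v01 || v03) = (v21 || v23) → (v02 && v03) = false → (v12 && v13) = false →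
    (v02 || v03) = (v12 || v13) →
    [v01, v02, v03, v10, v12, v13, v20, v21, v23, v30, v31, v32] ∈
      [[false, false, false, false, false, false, false, false, false, false, false, false],
      [false, false, false, true, false, false, true, false, false, true, false, false],
      [true, false, false, false, false, false, false, true, false, false, true, false],
      [false, true, false, false, true, false, false, false, false, false, false, true],
      [false, false, true, false, false, true, false, false, true, false, false, false],
      [true, false, false, true, false, false, false, false, true, false, false, true],
      [false, true, false, false, false, true, true, false, false, false, true, false],
      [false, false, true, false, true, false, false, true, false, true, false, false]] := by
  decide

theorem cycle_table (V : Fin 4 → Fin 4 → Bool)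
    (h1 : ∀ k i j, i ≠ j → k ≠ i → k ≠ j → (V k i && V k j) = false)
    (h2 : ∀ i j k l, i ≠ j → k ≠ i → k ≠ j → l ≠ i → l ≠ j → l ≠ k →
      (V k i || V k j) = (V l i || V l j)) :
    (∀ l i, l ≠ i → V l i = false) ∨ (∃ m, ∀ l i, l ≠ i → V l i = decide (i = m)) ∨
      ∃ q, ∀ l i, l ≠ i → V l i = decide (pairIndex l i = q) := by
  have key := cycle_table_aux (V 2 0) (V 2 1) (V 3 0) (V 3 1)
    (h1 2 0 1 (by decide) (by decide) (by decide)) (h1 3 0 1 (by decide) (by decide) (by decide))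
    (h2 0 1 2 3 (by decide) (by decide) (by decide) (by decide) (by decide) (by decide))
    (V 1 0) (V 1 2) (V 3 2)
    (h1 1 0 2 (by decide) (by decide) (by decide)) (h1 3 0 2 (by decide) (by decide) (by decide))
    (h2 0 2 1 3 (by decide) (by decide) (by decide) (by decide) (by decide) (by decide))
    (V 1 3) (V 2 3)
    (h1 1 0 3 (by decide) (by decide) (by decide)) (h1 2 0 3 (by decide) (by decide) (by decide))
    (h2 0 3 1 2 (by decide) (by decide) (by decide) (by decide) (by decide) (by decide))
    (V 0 1) (V 0 2)
    (h1 0 1 2 (by decide) (by decide) (by decide)) (h1 3 1 2 (by decide) (by decide) (by decide))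
    (h2 1 2 0 3 (by decide) (by decide) (by decide) (by decide) (by decide) (by decide))
    (V 0 3)
    (h1 0 1 3 (by decide) (by decide) (by decide)) (h1 2 1 3 (by decide) (by decide) (by decide))
    (h2 1 3 0 2 (by decide) (by decide) (by decide) (by decide) (by decide) (by decide))
    (h1 0 2 3 (by decide) (by decide) (by decide)) (h1 1 2 3 (by decide) (by decide) (by decide))
    (h2 2 3 0 1 (by decide) (by decide) (by decide) (by decide) (by decide) (by decide))
  have hall : ∀ f : Fin 4 → Fin 4 → Bool,
      [V 0 1, V 0 2, V 0 3, V 1 0, V 1 2, V 1 3, V 2 0, V 2 1, V 2 3, V 3 0, V 3 1, V 3 2] =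
      [f 0 1, f 0 2, f 0 3, f 1 0, f 1 2, f 1 3, f 2 0, f 2 1, f 2 3, f 3 0, f 3 1, f 3 2] →
      ∀ l i, l ≠ i → V l i = f l i := by
    intro f hf l i hne
    simp only [List.cons.injEq, and_true] at hf
    obtain ⟨f1, f2, f3, f4, f5, f6, f7, f8, f9, f10, f11, f12⟩ := hf
    fin_cases l <;> fin_cases i <;> first | exact absurd rfl hne | assumption
  simp only [List.mem_cons, List.not_mem_nil, or_false] at key
  rcases key with key | key | key | key | key | key | key | key
  · exact Or.inl (hall (fun _ _ => false) key)
  · exact Or.inr (Or.inl ⟨0, hall (fun _ i => decide (i = 0)) key⟩)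
  · exact Or.inr (Or.inl ⟨1, hall (fun _ i => decide (i = 1)) key⟩)
  · exact Or.inr (Or.inl ⟨2, hall (fun _ i => decide (i = 2)) key⟩)
  · exact Or.inr (Or.inl ⟨3, hall (fun _ i => decide (i = 3)) key⟩)
  · exact Or.inr (Or.inr ⟨0, hall (fun l i => decide (pairIndex l i = 0)) key⟩)
  · exact Or.inr (Or.inr ⟨1, hall (fun l i => decide (pairIndex l i = 1)) key⟩)
  · exact Or.inr (Or.inr ⟨2, hall (fun l i => decide (pairIndex l i = 2)) key⟩)

/-- The passage to the coordinates of `corner` removes the orientation, so that one table serves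
both cyclic orders. -/
theorem eq_tetrahedronCycle (ε : Bool) (v : Tangency 4 × Bool → Bool)
    (h1 : ∀ h, (v h && v (prevOf (cyclicOrder ε) h)) = false)
    (h2 : ∀ h, (v h || v (prevOf (cyclicOrder ε) h)) =
      (v (otherHalf h) || v (prevOf (cyclicOrder ε) (otherHalf h)))) :
    v = (fun _ => false) ∨ ∃ τ, v = tetrahedronCycle ε τ := by
  have hV : ∀ h, v h = v (corner ε (far ε h) (target h)) := fun h => by rw [corner_far]
  have hthird : ∀ k i j : Fin 4, i ≠ j → k ≠ i → k ≠ j → ∃ l, l ≠ i ∧ l ≠ j ∧ l ≠ k := by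
    decide
  have key := cycle_table (fun l i => v (corner ε l i)) ?_ ?_
  · rcases key with key | ⟨m, key⟩ | ⟨q, key⟩
    · left
      funext h
      rw [hV]
      exact key _ _ (far_ne_target ε h)
    · refine Or.inr ⟨Sum.inl m, ?_⟩
      funext h
      rw [hV]
      exact key _ _ (far_ne_target ε h)
    · refine Or.inr ⟨Sum.inr q, ?_⟩
      funext h
      rw [hV]
      exact key _ _ (far_ne_target ε h)
  · intro k i j hij hki hkj
    obtain ⟨l, h4, h5, h6⟩ := hthird k i j hij hki hkj
    obtain ⟨h, hij', rfl, rfl⟩ := exists_halfEdge_of_ne ε i j k l hij hki hkj h4 h5 h6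
    have := h1 h
    rw [← corner_prevOf ε h] at this
    nth_rewrite 1 [← corner_far ε h] at this
    rcases hij' with ⟨rfl, rfl⟩ | ⟨rfl, rfl⟩
    · rw [Bool.and_comm]
      exact this
    · exact this
  · intro i j k l h1 h2' h3 h4 h5 h6
    obtain ⟨h, hij, rfl, rfl⟩ := exists_halfEdge_of_ne ε i j k l h1 h2' h3 h4 h5 h6
    have e3 := corner_far ε (otherHalf h)
    have e4 := corner_prevOf ε (otherHalf h)
    rw [target_otherHalf] at e3
    rw [source_otherHalf] at e4
    rcases hij with ⟨rfl, rfl⟩ | ⟨rfl, rfl⟩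
    · rw [corner_far, corner_prevOf, e3, e4, Bool.or_comm, h2]
    · rw [corner_far, corner_prevOf, e3, e4, h2, Bool.or_comm]

theorem isCycleSet_tetrahedronCycle : ∀ ε τ, (∀ h : Tangency 4 × Bool,
      ¬ (tetrahedronCycle ε τ h ∧ tetrahedronCycle ε τ (prevOf (cyclicOrder ε) h))) ∧
    ∀ h : Tangency 4 × Bool,
      (tetrahedronCycle ε τ h || tetrahedronCycle ε τ (prevOf (cyclicOrder ε) h)) =
        (tetrahedronCycle ε τ (otherHalf h) ||
          tetrahedronCycle ε τ (prevOf (cyclicOrder ε) (otherHalf h))) := by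
  decide +kernel

theorem orbits_vertices_four : ∀ ε, ∀ h h' : Tangency 4 × Bool, far ε h = far ε h' →
    h' = h ∨ h' = nextOf (cyclicOrder ε) h ∨
      h' = nextOf (cyclicOrder ε) (nextOf (cyclicOrder ε) h) := by
  decide +kernel

theorem orbits_faces_four : ∀ ε, ∀ h h' : Tangency 4 × Bool, source h = source h' →
    h' = h ∨ h' = nextOf (cyclicOrder ε) (otherHalf h) ∨
      h' = nextOf (cyclicOrder ε) (otherHalf (nextOf (cyclicOrder ε) (otherHalf h))) := by
  decide +kernel

theorem card_vertices_four (ε : Bool) :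
    Nat.card (Quot fun h h' : Tangency 4 × Bool => nextOf (cyclicOrder ε) h = h') = 4 :=
  Nat.card_quot_orbits _ (far ε) (by revert ε; decide +kernel) (by revert ε; decide +kernel)
    (orbits_vertices_four ε)

theorem card_faces_four (ε : Bool) : Nat.card (Quot fun h h' : Tangency 4 × Bool =>
    nextOf (cyclicOrder ε) (otherHalf h) = h') = 4 :=
  Nat.card_quot_orbits (fun h => nextOf (cyclicOrder ε) (otherHalf h)) source
    (by revert ε; decide +kernel) (by revert ε; decide +kernel) (orbits_faces_four ε)

theorem card_components_four (ε : Bool) : Nat.card (Quot fun h h' : Tangency 4 × Bool =>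
    nextOf (cyclicOrder ε) h = h' ∨ otherHalf h = h') = 1 :=
  Nat.card_quot_connected _ _ (⟨(0, 1), by decide⟩, false) (by revert ε; decide +kernel)

variable {D : Fin 4 → Disk} {x : Fin 4 → ℕ} {ε : Bool}
  (hnext : (natNetwork D x).next = nextOf (cyclicOrder ε))

theorem fourNetwork_isSpinNetwork (hnext : (natNetwork D x).next = nextOf (cyclicOrder ε)) :
    (natNetwork D x).IsSpinNetwork := by
  refine ⟨fun h => Or.inr (natNetwork_atAdmissibleVertex hnext (isTrivalent_cyclicOrder ε) h), ?_⟩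
  unfold LabelledMap.IsPlanar
  rw [hnext]
  change Nat.card (Quot fun h h' : Tangency 4 × Bool => nextOf (cyclicOrder ε) h = h') +
    Nat.card (Quot fun h h' : Tangency 4 × Bool =>
      nextOf (cyclicOrder ε) (otherHalf h) = h') =
    Fintype.card (Tangency 4) + 2 * Nat.card (Quot fun h h' : Tangency 4 × Bool =>
      nextOf (cyclicOrder ε) h = h' ∨ otherHalf h = h')
  rw [card_vertices_four, card_faces_four, card_components_four]
  decide

noncomputable abbrev fourCorners : (natNetwork D x).Corners :=
  natCorners hnext (isTrivalent_cyclicOrder ε)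

theorem fourCorners_balanced : (fourCorners hnext).Balanced := fun a b ha hb =>
  even_crossings_four ε a b ha hb

theorem isCycleSet_four (v : Tangency 4 × Bool → Bool) : (fourCorners hnext).IsCycleSet v ↔
    v = (fun _ => false) ∨ ∃ τ, v = tetrahedronCycle ε τ := by
  constructor
  · rintro ⟨h1, h2⟩
    refine eq_tetrahedronCycle ε v (fun h => ?_) h2
    rw [Bool.eq_false_iff, ne_eq, Bool.and_eq_true]
    exact h1 h
  · rintro (rfl | ⟨τ, rfl⟩)
    · exact ⟨by simp, by simp⟩
    · exact isCycleSet_tetrahedronCycle ε τ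

theorem sum_tetrahedronCycle (M : Fin 4 ⊕ Fin 3 → ℕ) (h : Tangency 4 × Bool) :
    ∑ τ with tetrahedronCycle ε τ h, M τ =
      M (Sum.inl (target h)) + M (Sum.inr (pairIndex (far ε h) (target h))) := by
  rw [sum_filter, Fintype.sum_sum_type]
  simp [tetrahedronCycle]

/-- Each corner lies on one triangle and one quadrilateral, and each disk has a corner on every
quadrilateral. So the three quadrilaterals carry the same number `k`, the triangles carry the
differences, and `k` is at most each `x i`. -/
theorem cycle_sizes_iff (M : Fin 4 ⊕ Fin 3 → ℕ) :
    (∀ h : Tangency 4 × Bool, ∑ τ with tetrahedronCycle ε τ h, M τ = x (target h)) ↔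
      ∃ k ∈ range (min (min (x 0) (x 1)) (min (x 2) (x 3)) + 1),
        (Sum.elim (fun i => x i - k) fun _ => k) = M := by
  simp only [sum_tetrahedronCycle]
  constructor
  · intro H
    have hex : ∀ ε i q, ∃ h : Tangency 4 × Bool,
        target h = i ∧ pairIndex (far ε h) (target h) = q := by
      decide
    have H' : ∀ i q, M (Sum.inl i) + M (Sum.inr q) = x i := by
      intro i q
      obtain ⟨h, rfl, rfl⟩ := hex ε i q
      exact H h
    refine ⟨M (Sum.inr 0), ?_, ?_⟩
    · have h0 := H' 0 0
      have h1 := H' 1 0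
      have h2 := H' 2 0
      have h3 := H' 3 0
      simp only [mem_range]
      omega
    · funext τ
      rcases τ with i | q
      · have := H' i 0
        simp only [Sum.elim_inl]
        omega
      · have h0 := H' 0 0
        have h1 := H' 0 q
        simp only [Sum.elim_inr]
        omega
  · rintro ⟨k, hk, rfl⟩ h
    simp only [mem_range] at hk
    simp only [Sum.elim_inl, Sum.elim_inr]
    have : ∀ i, k ≤ x i := by
      intro i
      fin_cases i <;> simp <;> omega
    have := this (target h)
    omega

/-- The numbers on the disks are written as `a + k` and so on, which avoids truncated subtraction.
Cubes occur because each disk has three corners and there are three quadrilaterals. -/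
theorem fourCircle_term (a b c d k : ℕ) :
    (((a + k).factorial : ℚ) ^ 3 * ((b + k).factorial : ℚ) ^ 3 * ((c + k).factorial : ℚ) ^ 3 *
      ((d + k).factorial : ℚ) ^ 3 / ((a.factorial : ℚ) * b.factorial * c.factorial *
        d.factorial * (k.factorial : ℚ) ^ 3)) *
      ((-1) ^ (a + b + c + d + 3 * k) * ((a + b + c + d + 3 * k + 1).factorial : ℚ)) /
      (((a + k + (b + k)).factorial : ℚ) * (a + k + (c + k)).factorial *
        (a + k + (d + k)).factorial * (b + k + (c + k)).factorial * (b + k + (d + k)).factorial *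
        (c + k + (d + k)).factorial) =
    (-1) ^ (a + k + (b + k) + (c + k) + (d + k) + k) *
    (((a + k).choose k * (b + k).choose k * (c + k).choose k * (d + k).choose k *
      Nat.multinomial Finset.univ ![a + k, b + k, c + k, d + k, 1] : ℕ) : ℚ) /
    (((a + k + (b + k)).choose (a + k) * (a + k + (c + k)).choose (a + k) *
      (a + k + (d + k)).choose (a + k) * (b + k + (c + k)).choose (b + k) *
      (b + k + (d + k)).choose (b + k) * (c + k + (d + k)).choose (c + k) *
      (a + k + (b + k) + (c + k) + (d + k) + 1).choose k : ℕ) : ℚ) := by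
  have hne : ∀ n : ℕ, (n.factorial : ℚ) ≠ 0 := fun n => by
    exact_mod_cast Nat.factorial_ne_zero _
  have hmult : (Nat.multinomial Finset.univ ![a + k, b + k, c + k, d + k, 1] : ℚ) =
      ((a + k + (b + k) + (c + k) + (d + k) + 1).factorial : ℚ) / (((a + k).factorial : ℚ) *
        (b + k).factorial * (c + k).factorial * (d + k).factorial) := by
    rw [eq_div_iff (by simp [hne]), mul_comm]
    have := Nat.multinomial_spec Finset.univ ![a + k, b + k, c + k, d + k, 1]
    simp only [Fin.prod_univ_five, Fin.sum_univ_five, Matrix.cons_val] at this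
    rw [Nat.factorial_one, mul_one] at this
    exact_mod_cast this
  have hck : ∀ n : ℕ, ((n + k).choose k : ℚ) = ((n + k).factorial : ℚ) /
      ((n.factorial : ℚ) * k.factorial) := fun n => by
    rw [Nat.cast_choose ℚ (Nat.le_add_left k n), Nat.add_sub_cancel, mul_comm]
  have hS : ((a + k + (b + k) + (c + k) + (d + k) + 1).choose k : ℚ) =
      ((a + k + (b + k) + (c + k) + (d + k) + 1).factorial : ℚ) /
        (((a + b + c + d + 3 * k + 1).factorial : ℚ) * k.factorial) := by
    have : a + k + (b + k) + (c + k) + (d + k) + 1 = a + b + c + d + 3 * k + 1 + k := by ring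
    rw [this]
    exact hck _
  have hsign : ((-1 : ℚ)) ^ (a + k + (b + k) + (c + k) + (d + k) + k) =
      (-1) ^ (a + b + c + d + 3 * k) := by
    have : a + k + (b + k) + (c + k) + (d + k) + k = a + b + c + d + 3 * k + 2 * k := by ring
    rw [this, pow_add _ _ (2 * k), pow_mul]
    simp
  rw [hsign]
  push_cast
  rw [hmult, hS, hck, hck, hck, hck]
  simp only [Nat.cast_add_choose]
  have h0 := hne k
  have h1 := hne a
  have h2 := hne b
  have h3 := hne c
  have h4 := hne d
  have h5 := hne (a + k)
  have h6 := hne (b + k)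
  have h7 := hne (c + k)
  have h8 := hne (d + k)
  have h9 := hne (a + k + (b + k) + (c + k) + (d + k) + 1)
  have h10 := hne (a + b + c + d + 3 * k + 1)
  have h11 := hne (a + k + (b + k))
  have h12 := hne (a + k + (c + k))
  have h13 := hne (a + k + (d + k))
  have h14 := hne (b + k + (c + k))
  have h15 := hne (b + k + (d + k))
  have h16 := hne (c + k + (d + k))
  generalize ((a + k + (b + k) + (c + k) + (d + k) + 1).factorial : ℚ) = f9 at *
  generalize ((a + b + c + d + 3 * k + 1).factorial : ℚ) = f10 at *
  generalize ((a + k + (b + k)).factorial : ℚ) = f11 at *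
  generalize ((a + k + (c + k)).factorial : ℚ) = f12 at *
  generalize ((a + k + (d + k)).factorial : ℚ) = f13 at *
  generalize ((b + k + (c + k)).factorial : ℚ) = f14 at *
  generalize ((b + k + (d + k)).factorial : ℚ) = f15 at *
  generalize ((c + k + (d + k)).factorial : ℚ) = f16 at *
  generalize ((a + k).factorial : ℚ) = f5 at *
  generalize ((b + k).factorial : ℚ) = f6 at *
  generalize ((c + k).factorial : ℚ) = f7 at *
  generalize ((d + k).factorial : ℚ) = f8 at *
  field_simp

theorem fourNetwork_evaluation (hnext : (natNetwork D x).next = nextOf (cyclicOrder ε)) :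
    (natNetwork D x).evaluation = fourCircleSum (x 0) (x 1) (x 2) (x 3) := by
  rw [(fourCorners hnext).evaluation_eq_sum_cycles (fourCorners_balanced hnext)
    (tetrahedronCycle ε) ?_ ?_ (isCycleSet_four hnext)
    (range (min (min (x 0) (x 1)) (min (x 2) (x 3)) + 1))
    (fun k => Sum.elim (fun i => x i - k) fun _ => k) ?_ cycle_sizes_iff]
  · have hlabel : ∏ e, (((natNetwork D x).label e).factorial : ℚ) =
        ((x 0 + x 1).factorial : ℚ) * (x 0 + x 2).factorial * (x 0 + x 3).factorial *
          (x 1 + x 2).factorial * (x 1 + x 3).factorial * (x 2 + x 3).factorial := by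
      refine (prod_tangency_four fun e => (((natNetwork D x).label e).factorial : ℚ)).trans ?_
      simp only [← mul_assoc]
      rfl
    have hsize : ∏ h, (((fourCorners hnext).size h).factorial : ℚ) =
        ((x 0).factorial : ℚ) ^ 3 * ((x 1).factorial : ℚ) ^ 3 * ((x 2).factorial : ℚ) ^ 3 *
          ((x 3).factorial : ℚ) ^ 3 := by
      change ∏ h : Tangency 4 × Bool, ((x (target h)).factorial : ℚ) = _
      rw [Fintype.prod_prod_type, prod_tangency_four]
      simp [target]
      ring
    rw [hlabel, hsize, fourCircleSum, sum_div]
    refine sum_congr rfl fun k hk => ?_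
    simp only [mem_range] at hk
    obtain ⟨a, ha⟩ := Nat.exists_eq_add_of_le' (show k ≤ x 0 by omega)
    obtain ⟨b, hb⟩ := Nat.exists_eq_add_of_le' (show k ≤ x 1 by omega)
    obtain ⟨c, hc⟩ := Nat.exists_eq_add_of_le' (show k ≤ x 2 by omega)
    obtain ⟨d, hd⟩ := Nat.exists_eq_add_of_le' (show k ≤ x 3 by omega)
    rw [ha, hb, hc, hd, ← fourCircle_term]
    simp only [Fintype.prod_sum_type, Fintype.sum_sum_type, Fin.prod_univ_four, Fin.prod_univ_three,
      Fin.sum_univ_four, Fin.sum_univ_three, Sum.elim_inl, Sum.elim_inr, ha, hb, hc, hd,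
      Nat.add_sub_cancel]
    have : k + k + k = 3 * k := by ring
    rw [this]
    ring
  · intro τ τ' h
    have : ∀ ε τ τ', (∀ h, tetrahedronCycle ε τ h = tetrahedronCycle ε τ' h) → τ = τ' := by decide
    exact this ε τ τ' (congrFun h)
  · intro τ h
    have : ∀ ε τ, ∃ h, tetrahedronCycle ε τ h = true := by decide
    obtain ⟨h', hh⟩ := this ε τ
    rw [h] at hh
    cases hh
  · intro k _ k' _ h
    exact congrFun h (Sum.inr 0)

end Four

/-! ### Tangent disks -/

namespace Disk

/-- The Lorentz product. -/
noncomputable def lorentz (v u : Fin 4 → ℝ) : ℝ := v 2 * u 2 + v 3 * u 3 - (v 0 * u 1 + v 1 * u 0) / 2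

theorem lorentz_add_left (v v' u : Fin 4 → ℝ) :
    lorentz (v + v') u = lorentz v u + lorentz v' u := by
  simp only [lorentz, Pi.add_apply]
  ring

theorem lorentz_smul_left (c : ℝ) (v u : Fin 4 → ℝ) : lorentz (c • v) u = c * lorentz v u := by
  simp only [lorentz, Pi.smul_apply, smul_eq_mul]
  ring

theorem lorentz_comm (v u : Fin 4 → ℝ) : lorentz v u = lorentz u v := by
  simp only [lorentz]
  ring

theorem lorentz_add_right (v u u' : Fin 4 → ℝ) :
    lorentz v (u + u') = lorentz v u + lorentz v u' := by
  simp only [lorentz, Pi.add_apply]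
  ring

theorem lorentz_smul_right (c : ℝ) (v u : Fin 4 → ℝ) : lorentz v (c • u) = c * lorentz v u := by
  simp only [lorentz, Pi.smul_apply, smul_eq_mul]
  ring

theorem lift_infty : lift OnePoint.infty = ![0, 1, 0, 0] := rfl

theorem lift_coe (z : ℂ) : lift z = ![1, Complex.normSq z, z.re, z.im] := rfl

/-- The coordinates of a disk as a unit vector. -/
def vec (D : Disk) : Fin 4 → ℝ := ![D.curv, D.cocurv, D.w.re, D.w.im]

theorem lorentz_vec_self (D : Disk) : lorentz D.vec D.vec = 1 := by
  have := D.normalized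
  rw [Complex.normSq_apply] at this
  simp only [lorentz, vec, Matrix.cons_val]
  linarith

theorem form_eq (D : Disk) (p : OnePoint ℂ) : D.form p = -2 * lorentz D.vec (lift p) := by
  induction p using OnePoint.rec with
  | infty =>
    change D.curv = _
    simp [lift_infty, lorentz, vec]
    ring
  | coe z =>
    change D.curv * Complex.normSq z - 2 * ((starRingEnd ℂ) D.w * z).re + D.cocurv = _
    simp [lift_coe, lorentz, vec]
    ring

theorem mem_carrier_iff (D : Disk) (p : OnePoint ℂ) :
    p ∈ D.carrier ↔ 0 ≤ lorentz D.vec (lift p) := by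
  change D.form p ≤ 0 ↔ _
  rw [form_eq]
  constructor <;> intro h <;> linarith

theorem mem_inner_iff (D : Disk) (p : OnePoint ℂ) :
    p ∈ D.inner ↔ 0 < lorentz D.vec (lift p) := by
  change D.form p < 0 ↔ _
  rw [form_eq]
  constructor <;> intro h <;> linarith

theorem lorentz_lift_self (p : OnePoint ℂ) : lorentz (lift p) (lift p) = 0 := by
  induction p using OnePoint.rec with
  | infty => simp [lift_infty, lorentz]
  | coe z =>
    simp [lift_coe, lorentz, Complex.normSq_apply]

theorem lift_pos (p : OnePoint ℂ) : 0 < lift p 0 + lift p 1 := by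
  induction p using OnePoint.rec with
  | infty => simp [lift_infty]
  | coe z =>
    have := Complex.normSq_nonneg z
    simp [lift_coe]
    linarith

theorem lift_zero_nonneg (p : OnePoint ℂ) : 0 ≤ lift p 0 := by
  induction p using OnePoint.rec with
  | infty => simp [lift_infty]
  | coe z => simp [lift_coe]

/-- The future light cone is the cone over the sphere: divide by `u 0`, or by `u 1` at infinity. -/
theorem exists_lift (u : Fin 4 → ℝ) (h0 : lorentz u u = 0) (h1 : 0 < u 0 + u 1) :
    ∃ p, ∃ c : ℝ, 0 < c ∧ u = c • lift p := by
  simp only [lorentz] at h0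
  have hn : u 0 * u 1 = u 2 ^ 2 + u 3 ^ 2 := by linarith
  rcases lt_trichotomy (u 0) 0 with hu | hu | hu
  · nlinarith [sq_nonneg (u 2), sq_nonneg (u 3)]
  · rw [hu] at hn h1
    have h2 : u 2 = 0 := by nlinarith [sq_nonneg (u 2), sq_nonneg (u 3)]
    have h3 : u 3 = 0 := by nlinarith [sq_nonneg (u 2), sq_nonneg (u 3)]
    refine ⟨OnePoint.infty, u 1, by linarith, ?_⟩
    funext i
    fin_cases i <;> simp [lift_infty, hu, h2, h3]
  · refine ⟨((⟨u 2 / u 0, u 3 / u 0⟩ : ℂ) : OnePoint ℂ), u 0, hu, ?_⟩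
    funext i
    fin_cases i <;> simp [lift_coe, Complex.normSq_apply]
    · field_simp
      linarith
    · field_simp
    · field_simp

/-- For finite points the product is -|z - z'|²/2; with infinity it is -1/2. -/
theorem lorentz_lift_neg {p q : OnePoint ℂ} (h : p ≠ q) : lorentz (lift p) (lift q) < 0 := by
  induction p using OnePoint.rec with
  | infty =>
    induction q using OnePoint.rec with
    | infty => exact absurd rfl h
    | coe z => simp [lift_infty, lift_coe, lorentz]
  | coe z =>
    induction q using OnePoint.rec with
    | infty => simp [lift_infty, lift_coe, lorentz]
    | coe z' =>
      have hne : z - z' ≠ 0 := fun h' => h (by rw [sub_eq_zero.1 h'])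
      have := Complex.normSq_pos.2 hne
      rw [Complex.normSq_apply] at this
      simp [lift_coe, lorentz, Complex.normSq_apply] at this ⊢
      nlinarith

/-- A vector orthogonal to a null vector is spacelike or proportional to it. -/
theorem eq_smul_lift (p : OnePoint ℂ) (y : Fin 4 → ℝ) (h0 : lorentz y (lift p) = 0)
    (h1 : lorentz y y ≤ 0) : ∃ c : ℝ, y = c • lift p := by
  induction p using OnePoint.rec with
  | infty =>
    simp [lift_infty, lorentz] at h0 h1
    rw [h0] at h1
    have h2 : y 2 = 0 := by nlinarith [mul_self_nonneg (y 2), mul_self_nonneg (y 3)]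
    have h3 : y 3 = 0 := by nlinarith [mul_self_nonneg (y 2), mul_self_nonneg (y 3)]
    refine ⟨y 1, ?_⟩
    funext i
    fin_cases i <;> simp [lift_infty, h0, h2, h3]
  | coe z =>
    simp [lift_coe, lorentz, Complex.normSq_apply] at h0 h1
    have e1 : y 1 = 2 * (y 2 * z.re + y 3 * z.im) - y 0 * (z.re * z.re + z.im * z.im) := by
      linarith
    have e2 : (y 2 - y 0 * z.re) ^ 2 + (y 3 - y 0 * z.im) ^ 2 ≤ 0 := by
      rw [e1] at h1
      nlinarith
    have h2 : y 2 - y 0 * z.re = 0 := by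
      nlinarith [sq_nonneg (y 2 - y 0 * z.re), sq_nonneg (y 3 - y 0 * z.im)]
    have h3 : y 3 - y 0 * z.im = 0 := by
      nlinarith [sq_nonneg (y 2 - y 0 * z.re), sq_nonneg (y 3 - y 0 * z.im)]
    have h2 : y 2 = y 0 * z.re := by linarith
    have h3 : y 3 = y 0 * z.im := by linarith
    refine ⟨y 0, ?_⟩
    funext i
    fin_cases i <;> simp [lift_coe, Complex.normSq_apply, h2, h3]
    rw [e1, h2, h3]
    ring

theorem exists_boundary_pair (D : Disk) : ∃ p q : OnePoint ℂ, p ≠ q ∧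
    lorentz D.vec (lift p) = 0 ∧ lorentz D.vec (lift q) = 0 := by
  have hD := D.normalized
  rw [Complex.normSq_apply] at hD
  by_cases hk : D.curv = 0
  -- For a half-plane: infinity and the foot of the perpendicular from the origin. Otherwise, below,
  -- the two ends of the horizontal diameter.
  · refine ⟨OnePoint.infty, ((⟨D.w.re * D.cocurv / 2, D.w.im * D.cocurv / 2⟩ : ℂ) : OnePoint ℂ),
      OnePoint.infty_ne_coe _, ?_, ?_⟩
    · simp [lift_infty, lorentz, vec, hk]
    · rw [hk] at hD
      simp [lift_coe, lorentz, vec, hk]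
      linear_combination D.cocurv / 2 * hD
  · have key : ∀ s : ℝ, s ^ 2 = 1 → lorentz D.vec
        (lift ((⟨(D.w.re + s) / D.curv, D.w.im / D.curv⟩ : ℂ) : OnePoint ℂ)) = 0 := by
      intro s hs
      simp [lift_coe, lorentz, vec, Complex.normSq_apply]
      field_simp
      linear_combination hD - hs
    refine ⟨_, _, ?_, key 1 (by norm_num), key (-1) (by norm_num)⟩
    intro h
    have := congrArg Complex.re (OnePoint.coe_injective h)
    simp only at this
    field_simp at this
    linarith

theorem exists_boundary_ne (D : Disk) (p : OnePoint ℂ) :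
    ∃ q, q ≠ p ∧ lorentz D.vec (lift q) = 0 := by
  obtain ⟨a, b, hab, ha, hb⟩ := D.exists_boundary_pair
  by_cases h : a = p
  · exact ⟨b, h ▸ hab.symm, hb⟩
  · exact ⟨a, h, ha⟩

open Filter Topology in
/-- Moving a point in the direction of an orthogonal vector. -/
theorem exists_common_inner {p : OnePoint ℂ} {v e y : Fin 4 → ℝ} (hy : lorentz (lift p) y = 0)
    (hv : 0 < lorentz v (lift p) ∨ lorentz v (lift p) = 0 ∧ 0 < lorentz v y)
    (he : 0 < lorentz e (lift p) ∨ lorentz e (lift p) = 0 ∧ 0 < lorentz e y) :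
    ∃ q, 0 < lorentz v (lift q) ∧ 0 < lorentz e (lift q) := by
  obtain ⟨q, hq⟩ : ∃ q, p ≠ q := by
    by_cases h : p = OnePoint.infty
    · exact ⟨((0 : ℂ) : OnePoint ℂ), h ▸ OnePoint.infty_ne_coe _⟩
    · exact ⟨_, h⟩
  have hQ := lorentz_lift_neg hq
  set u := lift p with hu
  set Q := lorentz u (lift q) with hQdef
  set R := lorentz y (lift q) with hR
  set Y := lorentz y y with hY
  -- The vector `u + ε • y` has square `ε ^ 2 * Y`. Adding a multiple of `lift q` makes it null
  -- again, and the factor `-2 * (Q + ε * R)`, positive for small `ε`, clears the denominator.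
  let W (ε : ℝ) : Fin 4 → ℝ := (-2 * (Q + ε * R)) • (u + ε • y) + (ε ^ 2 * Y) • lift q
  have hnull : ∀ ε, lorentz (W ε) (W ε) = 0 := by
    intro ε
    simp only [W, lorentz_add_left, lorentz_add_right, lorentz_smul_left, lorentz_smul_right]
    rw [lorentz_comm y u, lorentz_comm (lift q) u, lorentz_comm (lift q) y, hu, lorentz_lift_self,
      lorentz_lift_self, ← hu, hy, ← hQdef, ← hR, ← hY]
    ring
  have hW : ∀ v ε, lorentz v (W ε) = -2 * (Q + ε * R) * (lorentz v u + ε * lorentz v y) +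
      ε ^ 2 * Y * lorentz v (lift q) := by
    intro v ε
    simp only [W, lorentz_add_right, lorentz_smul_right]
  have hevent : ∀ f : ℝ → ℝ, Continuous f → 0 < f 0 → ∀ᶠ ε in 𝓝[>] (0 : ℝ), 0 < f ε := by
    intro f hf h0
    exact (hf.tendsto 0).eventually_const_lt h0 |>.filter_mono nhdsWithin_le_nhds
  have hpos : ∀ v, (0 < lorentz v u ∨ lorentz v u = 0 ∧ 0 < lorentz v y) →
      ∀ᶠ ε in 𝓝[>] (0 : ℝ), 0 < lorentz v (W ε) := by
    rintro v (h | ⟨h, h'⟩)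
    · refine hevent (fun ε => lorentz v (W ε)) ?_ ?_
      · simp only [hW]
        fun_prop
      · simp only [hW]
        nlinarith
    · have := hevent (fun ε => -2 * (Q + ε * R) * lorentz v y + ε * Y * lorentz v (lift q))
        (by fun_prop) (by nlinarith)
      filter_upwards [this, self_mem_nhdsWithin] with ε h1 h2
      rw [hW, h]
      have : 0 < ε * (-2 * (Q + ε * R) * lorentz v y + ε * Y * lorentz v (lift q)) :=
        mul_pos h2 h1
      nlinarith
  have hfut : ∀ᶠ ε in 𝓝[>] (0 : ℝ), 0 < W ε 0 + W ε 1 := by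
    refine hevent (fun ε => W ε 0 + W ε 1) ?_ ?_
    · simp only [W, Pi.add_apply, Pi.smul_apply, smul_eq_mul]
      fun_prop
    · have := lift_pos p
      simp only [W, Pi.add_apply, Pi.smul_apply, smul_eq_mul, ← hu] at this ⊢
      nlinarith
  obtain ⟨ε, h1, h2, h3⟩ := ((hpos v hv).and ((hpos e he).and hfut)).exists
  obtain ⟨p', c, hc, hp'⟩ := exists_lift (W ε) (hnull ε) h3
  rw [hp', lorentz_smul_right] at h1 h2
  exact ⟨p', pos_of_mul_pos_right h1 hc.le, pos_of_mul_pos_right h2 hc.le⟩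

/-- The unit vectors of tangent disks add up to a positive multiple of the point of tangency. -/
theorem Tangent.exists_add_eq {D E : Disk} (h : D.Tangent E) {p : OnePoint ℂ}
    (hp : p ∈ D.carrier ∩ E.carrier) : ∃ c : ℝ, 0 < c ∧ D.vec + E.vec = c • lift p := by
  obtain ⟨hdisj, p', hp'⟩ := h
  have huniq : ∀ q, q ∈ D.carrier → q ∈ E.carrier → q = p := by
    intro q h1 h2
    have h3 : q ∈ D.carrier ∩ E.carrier := ⟨h1, h2⟩
    rw [hp'] at h3 hp
    exact h3.trans hp.symm
  have hno : ¬ ∃ q, 0 < lorentz D.vec (lift q) ∧ 0 < lorentz E.vec (lift q) := by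
    rintro ⟨q, h1, h2⟩
    exact Set.disjoint_left.1 hdisj ((D.mem_inner_iff q).2 h1) ((E.mem_inner_iff q).2 h2)
  have hs := (D.mem_carrier_iff p).1 hp.1
  have ht := (E.mem_carrier_iff p).1 hp.2
  have hv := D.lorentz_vec_self
  have he := E.lorentz_vec_self
  -- If the common point were interior to one disk and on the boundary of the other, moving it along
  -- the unit vector of the latter would make it interior to both.
  have h0 : lorentz D.vec (lift p) = 0 ∧ lorentz E.vec (lift p) = 0 := by
    rcases hs.lt_or_eq with hs | hs <;> rcases ht.lt_or_eq with ht | ht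
    · exact (hno ⟨p, hs, ht⟩).elim
    · refine (hno (exists_common_inner (p := p) (y := E.vec) ?_ (Or.inl hs)
        (Or.inr ⟨ht.symm, ?_⟩))).elim
      · rw [lorentz_comm, ← ht]
      · rw [he]
        exact one_pos
    · refine (hno (exists_common_inner (p := p) (y := D.vec) ?_ (Or.inr ⟨hs.symm, ?_⟩)
        (Or.inl ht))).elim
      · rw [lorentz_comm, ← hs]
      · rw [hv]
        exact one_pos
    · exact ⟨hs.symm, ht.symm⟩
  -- Otherwise moving the point along the sum of the two vectors would lead into both interiors.
  have hc : lorentz D.vec E.vec ≤ -1 := by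
    by_contra hc
    refine hno (exists_common_inner (p := p) (y := D.vec + E.vec) ?_ (Or.inr ⟨h0.1, ?_⟩)
      (Or.inr ⟨h0.2, ?_⟩))
    · rw [lorentz_comm, lorentz_add_left, h0.1, h0.2, add_zero]
    · rw [lorentz_add_right, hv]
      linarith
    · rw [lorentz_add_right, he, lorentz_comm]
      linarith
  obtain ⟨c, hc'⟩ := eq_smul_lift p (D.vec + E.vec)
    (by rw [lorentz_add_left, h0.1, h0.2, add_zero])
    (by
      rw [lorentz_add_left, lorentz_add_right, lorentz_add_right, hv, he, lorentz_comm E.vec]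
      linarith)
  refine ⟨c, ?_, hc'⟩
  -- If the factor were not positive, every boundary point of `D` would belong to `E`, contrary to
  -- the uniqueness of the common point.
  by_contra hneg
  obtain ⟨q, hq, hq0⟩ := D.exists_boundary_ne p
  refine hq (huniq q ((D.mem_carrier_iff q).2 hq0.ge) ((E.mem_carrier_iff q).2 ?_))
  have h1 : lorentz (D.vec + E.vec) (lift q) = c * lorentz (lift p) (lift q) := by
    rw [hc', lorentz_smul_left]
  rw [lorentz_add_left, hq0, zero_add] at h1
  rw [h1]
  exact mul_nonneg_of_nonpos_of_nonpos (not_lt.1 hneg) (lorentz_lift_neg hq.symm).le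

theorem Tangent.exists_mem {D E : Disk} (h : D.Tangent E) : ∃ p, p ∈ D.carrier ∩ E.carrier := by
  obtain ⟨-, p, hp⟩ := h
  exact ⟨p, hp ▸ Set.mem_singleton p⟩

theorem Tangent.lorentz_eq {D E : Disk} (h : D.Tangent E) : lorentz D.vec E.vec = -1 := by
  obtain ⟨p, hp⟩ := h.exists_mem
  obtain ⟨c, -, hc⟩ := h.exists_add_eq hp
  have h1 : lorentz (D.vec + E.vec) (D.vec + E.vec) = 0 := by
    rw [hc, lorentz_smul_left, lorentz_smul_right, lorentz_lift_self]
    ring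
  rw [lorentz_add_left, lorentz_add_right, lorentz_add_right, lorentz_vec_self, lorentz_vec_self,
    lorentz_comm E.vec] at h1
  linarith

theorem Tangent.curv_add_nonneg {D E : Disk} (h : D.Tangent E) : 0 ≤ D.curv + E.curv := by
  obtain ⟨p, hp⟩ := h.exists_mem
  obtain ⟨c, hc, h1⟩ := h.exists_add_eq hp
  have h2 := congrFun h1 0
  simp only [vec, Pi.add_apply, Matrix.cons_val_zero, Pi.smul_apply, smul_eq_mul] at h2
  rw [h2]
  exact mul_nonneg hc.le (lift_zero_nonneg p)

/-- The orientation of four vectors. -/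
def orient (a b c d : Fin 4 → ℝ) : ℝ := (Matrix.of ![a, b, c, d]).det

theorem orient_eq (a b c d : Fin 4 → ℝ) : orient a b c d =
    (a 0 * b 1 - a 1 * b 0) * (c 2 * d 3 - c 3 * d 2) -
    (a 0 * b 2 - a 2 * b 0) * (c 1 * d 3 - c 3 * d 1) +
    (a 0 * b 3 - a 3 * b 0) * (c 1 * d 2 - c 2 * d 1) +
    (a 1 * b 2 - a 2 * b 1) * (c 0 * d 3 - c 3 * d 0) -
    (a 1 * b 3 - a 3 * b 1) * (c 0 * d 2 - c 2 * d 0) +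
    (a 2 * b 3 - a 3 * b 2) * (c 0 * d 1 - c 1 * d 0) := by
  unfold orient
  rw [Matrix.det_succ_row_zero]
  simp [Fin.sum_univ_succ, Matrix.det_fin_three, Fin.succAbove, Matrix.submatrix_apply]
  ring

/-- The Gram matrix has 1 on the diagonal and -1 elsewhere; its determinant is -16, so the vectors
are independent. -/
theorem orient_ne_zero {V : Fin 4 → Fin 4 → ℝ} (h1 : ∀ i, lorentz (V i) (V i) = 1)
    (h2 : ∀ i j, i ≠ j → lorentz (V i) (V j) = -1) : orient (V 0) (V 1) (V 2) (V 3) ≠ 0 := by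
  intro h0
  let G : Matrix (Fin 4) (Fin 4) ℝ :=
    !![0, -1/2, 0, 0; -1/2, 0, 0, 0; 0, 0, 1, 0; 0, 0, 0, 1]
  let M : Matrix (Fin 4) (Fin 4) ℝ := Matrix.of ![V 0, V 1, V 2, V 3]
  have hM : ∀ i, M i = V i := by
    intro i
    fin_cases i <;> rfl
  have hgram : M * G * M.transpose =
      !![1, -1, -1, -1; -1, 1, -1, -1; -1, -1, 1, -1; -1, -1, -1, 1] := by
    have hent : ∀ i j, (M * G * M.transpose) i j = lorentz (V i) (V j) := by
      intro i j
      simp [Matrix.mul_apply, Fin.sum_univ_four, G, lorentz, hM, Matrix.transpose_apply]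
      ring
    ext i j
    rw [hent]
    fin_cases i <;> fin_cases j <;> first | exact h1 _ | exact h2 _ _ (by decide)
  have hdet := congrArg Matrix.det hgram
  have hM0 : M.det = 0 := h0
  rw [Matrix.det_mul, Matrix.det_mul, hM0, zero_mul, zero_mul] at hdet
  have := orient_eq ![1, -1, -1, -1] ![-1, 1, -1, -1] ![-1, -1, 1, -1] ![-1, -1, -1, 1]
  change Matrix.det !![1, -1, -1, -1; -1, 1, -1, -1; -1, -1, 1, -1; -1, -1, -1, 1] = _ at this
  rw [← hdet] at this
  simp only [Matrix.cons_val] at this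
  norm_num at this

end Disk

/-! ### The cyclic order of the tangencies around four disks -/

section Successor

variable {D : Fin 4 → Disk}

open Disk

/-- In every case the rows undergo an even permutation. -/
theorem orient_cyclicOrder (V : Fin 4 → Fin 4 → ℝ) (j i : Fin 4) (h : i ≠ j) :
    orient (V j) (V i) (V (cyclicOrder true j i)) (V (cyclicOrder false j i)) =
      orient (V 0) (V 1) (V 2) (V 3) := by
  rw [orient_eq, orient_eq]
  fin_cases j <;> fin_cases i <;> first | exact absurd rfl h | (simp [cyclicOrder] <;> ring)

theorem orient_swap (a b c d : Fin 4 → ℝ) : orient a b d c = -orient a b c d := by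
  rw [orient_eq, orient_eq]
  ring

/-- The vector of each neighbour is a positive multiple of the lift of its point of tangency minus
the vector of `D j`, and subtracting the first row does not change a determinant. Thus the order of
the three points depends only on the disks. -/
theorem positivelyOrdered_iff (hD : MutuallyTangent D) {j i k l : Fin 4} (hi : i ≠ j) (hk : k ≠ j)
    (hl : l ≠ j) {p q r : OnePoint ℂ} (hp : p ∈ (D j).carrier ∩ (D i).carrier)
    (hq : q ∈ (D j).carrier ∩ (D k).carrier) (hr : r ∈ (D j).carrier ∩ (D l).carrier) :
    (D j).PositivelyOrdered p q r ↔ 0 < orient (D j).vec (D i).vec (D k).vec (D l).vec := by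
  obtain ⟨a, ha, hpa⟩ := (hD j i hi.symm).exists_add_eq hp
  obtain ⟨b, hb, hqb⟩ := (hD j k hk.symm).exists_add_eq hq
  obtain ⟨c, hc, hrc⟩ := (hD j l hl.symm).exists_add_eq hr
  have h1 : (D i).vec = a • lift p - (D j).vec := by rw [← hpa]; abel
  have h2 : (D k).vec = b • lift q - (D j).vec := by rw [← hqb]; abel
  have h3 : (D l).vec = c • lift r - (D j).vec := by rw [← hrc]; abel
  have key : orient (D j).vec (D i).vec (D k).vec (D l).vec =
      a * b * c * orient (D j).vec (lift p) (lift q) (lift r) := by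
    rw [h1, h2, h3, orient_eq, orient_eq]
    simp only [Pi.sub_apply, Pi.smul_apply, smul_eq_mul]
    ring
  rw [key]
  exact (mul_pos_iff_of_pos_left (by positivity)).symm

theorem cyclicOrder_distinct : ∀ j i : Fin 4, i ≠ j → ∀ ε, cyclicOrder ε j i ≠ j ∧
    cyclicOrder ε j i ≠ i ∧ ∀ l, l ≠ j → l ≠ i → l ≠ cyclicOrder ε j i →
      l = cyclicOrder (!ε) j i := by
  decide

/-- The sign of one determinant decides the order around all four disks at once. -/
theorem exists_cyclicOrder (hD : MutuallyTangent D) :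
    ∃ ε, ∀ j i (h : i ≠ j), (successor D j i h).1 = cyclicOrder ε j i := by
  set V : Fin 4 → Fin 4 → ℝ := fun i => (D i).vec with hV
  have hne : orient (V 0) (V 1) (V 2) (V 3) ≠ 0 :=
    orient_ne_zero (fun i => (D i).lorentz_vec_self) fun i j h => (hD i j h).lorentz_eq
  have hpos : ∃ ε, ∀ j i, i ≠ j →
      0 < orient (V j) (V i) (V (cyclicOrder ε j i)) (V (cyclicOrder (!ε) j i)) := by
    rcases lt_or_gt_of_ne hne with h | h
    · refine ⟨false, fun j i hij => ?_⟩
      rw [Bool.not_false, orient_swap, orient_cyclicOrder V j i hij]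
      linarith
    · refine ⟨true, fun j i hij => ?_⟩
      rw [Bool.not_true, orient_cyclicOrder V j i hij]
      exact h
  obtain ⟨ε, hε⟩ := hpos
  refine ⟨ε, fun j i hij => ?_⟩
  obtain ⟨h1, h2, h3⟩ := cyclicOrder_distinct j i hij ε
  obtain ⟨h4, h5, h6⟩ := cyclicOrder_distinct j i hij (!ε)
  have hex : ∃ k, Follows D j i k := by
    refine ⟨cyclicOrder ε j i, h1, h2, ?_⟩
    intro l hlj hli hlk p hp q hq r hr
    obtain rfl := h3 l hlj hli hlk
    exact (positivelyOrdered_iff hD hij h1 h4 hp hq hr).2 (hε j i hij)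
  unfold successor
  rw [dif_pos hex]
  obtain ⟨g1, g2, g3⟩ := hex.choose_spec
  -- If the chosen successor were the other candidate, the determinant with its last two rows
  -- exchanged would be positive too.
  by_contra hne
  have hk := h3 _ g1 g2 hne
  obtain ⟨p, hp⟩ := (hD j i hij.symm).exists_mem
  obtain ⟨q, hq⟩ := (hD j _ g1.symm).exists_mem
  obtain ⟨r, hr⟩ := (hD j _ h1.symm).exists_mem
  have g := g3 _ h1 h2 (Ne.symm hne) p hp q hq r hr
  rw [positivelyOrdered_iff hD hij g1 h1 hp hq hr, hk, orient_swap] at g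
  have := hε j i hij
  linarith

end Successor

/-! ### The proposition -/

theorem twoNetwork_evaluation_of_tangent (D : Fin 2 → Disk) (hD : MutuallyTangent D) (a b : ℤ)
    (ha : (D 0).curv = a) (hb : (D 1).curv = b) : (diskNetwork D ![a, b]).evaluation =
      (-1) ^ (a + b) * ((a + b + 1 : ℤ) : ℚ) := by
  -- One curvature may be negative, but the sum is a positive multiple of a nonnegative coordinate
  -- of the point of tangency, so `toNat` in the label loses nothing.
  have h := (hD 0 1 (by decide)).curv_add_nonneg
  rw [ha, hb] at h
  have hab : 0 ≤ a + b := by exact_mod_cast h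
  rw [twoNetwork_evaluation]
  simp only [Matrix.cons_val_zero, Matrix.cons_val_one]
  obtain ⟨m, hm⟩ := Int.eq_ofNat_of_zero_le hab
  rw [hm, Int.toNat_natCast, zpow_natCast]
  push_cast
  rfl

theorem natCast_cons_three (a b c : ℕ) :
    (![(a : ℤ), b, c] : Fin 3 → ℤ) = fun i => ((![a, b, c] i : ℕ) : ℤ) := by
  funext i
  fin_cases i <;> rfl

theorem natCast_cons_four (a b c d : ℕ) :
    (![(a : ℤ), b, c, d] : Fin 4 → ℤ) = fun i => ((![a, b, c, d] i : ℕ) : ℤ) := by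
  funext i
  fin_cases i <;> rfl

theorem fourDisks (D : Fin 4 → Disk) (hD : MutuallyTangent D) (a b c d : ℕ) :
    (diskNetwork D ![(a : ℤ), b, c, d]).IsSpinNetwork ∧
      (diskNetwork D ![(a : ℤ), b, c, d]).evaluation = fourCircleSum a b c d := by
  obtain ⟨ε, hε⟩ := exists_cyclicOrder hD
  rw [natCast_cons_four]
  have hnext := diskNetwork_next D (fun i => ((![a, b, c, d] i : ℕ) : ℤ)) _ hε
  exact ⟨fourNetwork_isSpinNetwork hnext, fourNetwork_evaluation hnext⟩

theorem proposition5p1 :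
    -- two circles
    (∀ D : Fin 2 → Disk, MutuallyTangent D →
      ∀ a b : ℤ, (D 0).curv = a → (D 1).curv = b →
        (diskNetwork D ![a, b]).IsSpinNetwork ∧
        (diskNetwork D ![a, b]).evaluation = (-1) ^ (a + b) * ((a + b + 1 : ℤ) : ℚ)) ∧
    -- three circles
    (∀ D : Fin 3 → Disk, MutuallyTangent D →
      ∀ a b c : ℕ, (D 0).curv = a → (D 1).curv = b → (D 2).curv = c →
        (diskNetwork D ![(a : ℤ), b, c]).IsSpinNetwork ∧
        (diskNetwork D ![(a : ℤ), b, c]).evaluation =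
          (-1) ^ (a + b + c) *
            ((a.factorial * b.factorial * c.factorial * (a + b + c + 1).factorial : ℕ) : ℚ) /
            (((a + b).factorial * (b + c).factorial * (c + a).factorial : ℕ) : ℚ)) ∧
    -- four circles (Descartes configuration)
    (∀ D : Fin 4 → Disk, MutuallyTangent D →
      ∀ a b c d : ℕ, (D 0).curv = a → (D 1).curv = b → (D 2).curv = c → (D 3).curv = d →
        (diskNetwork D ![(a : ℤ), b, c, d]).IsSpinNetwork ∧
        (diskNetwork D ![(a : ℤ), b, c, d]).evaluation = fourCircleSum a b c d) ∧
    -- four circles that carry arbitrary natural numbers in place of their curvatures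
    (∀ D : Fin 4 → Disk, MutuallyTangent D → ∀ a b c d : ℕ,
        (diskNetwork D ![(a : ℤ), b, c, d]).IsSpinNetwork ∧
        (diskNetwork D ![(a : ℤ), b, c, d]).evaluation = fourCircleSum a b c d) := by
  refine ⟨fun D hD a b ha hb => ⟨twoNetwork_isSpinNetwork D _,
    twoNetwork_evaluation_of_tangent D hD a b ha hb⟩, fun D _ a b c _ _ _ => ?_,
    fun D hD a b c d _ _ _ _ => fourDisks D hD a b c d, fourDisks⟩
  rw [natCast_cons_three]
  exact ⟨threeNetwork_isSpinNetwork D _, threeNetwork_evaluation D _⟩
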